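/- Let $k$ be an algebraically closed field (of any characteristic). An endomorphism of $\mathbb{A}^2_k$ is a pair $f=(f_1,f_2)$ of polynomials in $k[x_1,x_2]$, its degree is $\deg(f)=\max(\deg f_1,\deg f_2)$, and $\mathrm{Aut}(\mathbb{A}^2_k)$ is the group, under composition, of the endomorphisms that have an inverse endomorphism. Let $\mathrm{SAut}(\mathbb{A}^2_k)\subset\mathrm{Aut}(\mathbb{A}^2_k)$ be the subgroup of elements with Jacobian determinant $\det(\partial f_i/\partial x_j)=1$. An element $f$ is called algebraic if the sequence $(\deg(f^m))_{m\in\mathbb{N}}$ is bounded. For an algebraic variety $A$ over $k$, a morphism $A\to\mathrm{Aut}(\mathbb{A}^2_k)$ is a map $a\mapsto F_a$ from the $k$-points of $A$ given by an $A$-automorphism of $A\times\mathbb{A}^2$, $(a,x)\mapsto(a,F_a(x))$. A subset of $\mathrm{Aut}(\mathbb{A}^2_k)$ is closed (for the Zariski topology) if its preimage under every morphism $A\to\mathrm{Aut}(\mathbb{A}^2_k)$, for every algebraic variety $A$ over $k$, is closed in $A$; $\mathrm{SAut}(\mathbb{A}^2_k)$ carries the induced topology. Then: (1) An element $f\in\mathrm{SAut}(\mathbb{A}^2_k)$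 is algebraic if and only if $\deg(f^2)\le\deg(f)$. (2) The set of algebraic elements of $\mathrm{SAut}(\mathbb{A}^2_k)$ is closed in $\mathrm{SAut}(\mathbb{A}^2_k)$. -/

import Mathlib

open CategoryTheory AlgebraicGeometry

universe u

/-- A polynomial endomorphism `x ↦ (f₁(x), …, fₙ(x))` of affine `n`-space over `R`, given by its
components `fᵢ ∈ R[x₁, …, xₙ]`. -/
@[ext]
structure PolyEnd (n : ℕ) (R : Type u) [CommRing R] where
  /-- the components `fᵢ` -/
  comp : Fin n → MvPolynomial (Fin n) R

namespace PolyEnd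

noncomputable section

variable {n : ℕ} {R : Type u} [CommRing R]

/-- The identity is `(x₁, …, xₙ)`. -/
instance : One (PolyEnd n R) := ⟨⟨MvPolynomial.X⟩⟩

/-- `f * g` is the composition `f ∘ g`, with components `fᵢ(g₁, …, gₙ)`. -/
instance : Mul (PolyEnd n R) := ⟨fun f g => ⟨fun i => MvPolynomial.bind₁ g.comp (f.comp i)⟩⟩

theorem one_comp (i : Fin n) : (1 : PolyEnd n R).comp i = MvPolynomial.X i := rfl

theorem mul_comp (f g : PolyEnd n R) (i : Fin n) :
    (f * g).comp i = MvPolynomial.bind₁ g.comp (f.comp i) := rfl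

instance : Monoid (PolyEnd n R) where
  mul_assoc f g h := by
    ext1; funext i
    simp only [mul_comp, MvPolynomial.bind₁_bind₁]
    rfl
  one_mul f := by
    ext1; funext i
    simp only [mul_comp, one_comp, MvPolynomial.bind₁_X_right]
  mul_one f := by
    ext1; funext i
    exact MvPolynomial.aeval_X_left_apply (f.comp i)

/-- The degree of `f` is the maximum of the (total) degrees of its components. -/
def degree (f : PolyEnd n R) : ℕ := Finset.univ.sup fun i => (f.comp i).totalDegree

/-- The Jacobian matrix `(∂fᵢ/∂xⱼ)`. -/
def jacMatrix (f : PolyEnd n R) : Matrix (Fin n) (Fin n) (MvPolynomial (Fin n) R) :=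
  Matrix.of fun i j => MvPolynomial.pderiv j (f.comp i)

/-- The Jacobian determinant of `f`. -/
def jac (f : PolyEnd n R) : MvPolynomial (Fin n) R := f.jacMatrix.det

theorem pderiv_bind₁ (g : Fin n → MvPolynomial (Fin n) R) (j : Fin n)
    (p : MvPolynomial (Fin n) R) :
    MvPolynomial.pderiv j (MvPolynomial.bind₁ g p) =
      ∑ i, MvPolynomial.bind₁ g (MvPolynomial.pderiv i p) * MvPolynomial.pderiv j (g i) := by
  induction p using MvPolynomial.induction_on with
  | C a => simp
  | add p q hp hq => simp [hp, hq, add_mul, Finset.sum_add_distrib]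
  | mul_X p m hp =>
    simp only [map_mul, MvPolynomial.bind₁_X_right, Derivation.leibniz, hp, smul_eq_mul,
      MvPolynomial.pderiv_X, map_add, add_mul, Finset.sum_add_distrib, Finset.mul_sum]
    congr 1
    · rw [Finset.sum_eq_single m]
      · simp
      · intro b _ hb
        simp [hb.symm]
      · simp
    · exact Finset.sum_congr rfl fun i _ => by ring

theorem jac_one : (1 : PolyEnd n R).jac = 1 := by
  have : (1 : PolyEnd n R).jacMatrix = 1 := by
    ext1 i j
    simp [jacMatrix, one_comp, MvPolynomial.pderiv_X, Matrix.one_apply, Pi.single_apply]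
  rw [jac, this, Matrix.det_one]

theorem jac_mul (f g : PolyEnd n R) :
    (f * g).jac = MvPolynomial.bind₁ g.comp f.jac * g.jac := by
  have : (f * g).jacMatrix =
      (MvPolynomial.bind₁ g.comp).toRingHom.mapMatrix f.jacMatrix * g.jacMatrix := by
    ext1 i j
    simp [jacMatrix, mul_comp, pderiv_bind₁, Matrix.mul_apply]
  rw [jac, this, Matrix.det_mul, ← RingHom.map_det]
  rfl

end

end PolyEnd

/-- The group `Aut(𝔸ⁿ_R)` of polynomial automorphisms: the invertible elements of the monoid of
polynomial endomorphisms under composition. -/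
abbrev PolyAut (n : ℕ) (R : Type u) [CommRing R] : Type u := (PolyEnd n R)ˣ

/-- The subgroup `SAut(𝔸ⁿ_R)` of automorphisms of Jacobian `1`. -/
def SAut (n : ℕ) (R : Type u) [CommRing R] : Subgroup (PolyAut n R) where
  carrier := {f | f.val.jac = 1}
  one_mem' := PolyEnd.jac_one
  mul_mem' {f g} hf hg := by
    simp only [Set.mem_ofPred_eq] at hf hg ⊢
    rw [Units.val_mul, PolyEnd.jac_mul, hf, hg, map_one, one_mul]
  inv_mem' {f} hf := by
    simp only [Set.mem_ofPred_eq] at hf ⊢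
    have h := PolyEnd.jac_mul f.val (f⁻¹).val
    rw [f.mul_inv, PolyEnd.jac_one, hf, map_one, one_mul] at h
    exact h.symm

namespace PolyAut

variable {n : ℕ} {R : Type u} [CommRing R]

/-- The degree of an automorphism. -/
noncomputable def degree (f : PolyAut n R) : ℕ := PolyEnd.degree f.val

/-- `f` is algebraic if the sequence `deg(f^m)`, `m ∈ ℕ`, is bounded. -/
def IsAlgebraic (f : PolyAut n R) : Prop :=
  BddAbove (Set.range fun m : ℕ => degree (f ^ m))

end PolyAut

section Topology

/-- A `k`-scheme is an algebraic variety if it is of finite type, separated and reduced over `k`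
(for `k` an algebraically closed field; irreducibility is not required). -/
structure IsAlgVariety (k : Type u) [Field k] (A : Scheme.{u})
    (π : A ⟶ Spec (CommRingCat.of k)) : Prop where
  locallyOfFiniteType : LocallyOfFiniteType π
  quasiCompact : QuasiCompact π
  isSeparated : IsSeparated π
  isReduced : IsReduced A

/-- The `k`-points of a `k`-scheme `A`, i.e. the sections of the structure morphism. -/
def KPoint {k : Type u} [Field k] {A : Scheme.{u}} (π : A ⟶ Spec (CommRingCat.of k)) : Type u :=
  {a : Spec (CommRingCat.of k) ⟶ A // a ≫ π = 𝟙 _}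

/-- The Zariski topology on the `k`-points: induced by sending a `k`-point `Spec k ⟶ A` to its
image point in the topological space underlying `A`. -/
noncomputable instance KPoint.instTopologicalSpace {k : Type u} [Field k] {A : Scheme.{u}}
    (π : A ⟶ Spec (CommRingCat.of k)) : TopologicalSpace (KPoint π) :=
  TopologicalSpace.induced
    (fun a => (a.1 : Spec (CommRingCat.of k) ⟶ A) (IsLocalRing.closedPoint k)) inferInstance

/-- The affine space `A × 𝔸ⁿ` over a scheme `A`. -/
noncomputable abbrev affSpace (n : ℕ) (A : Scheme.{u}) : Scheme.{u} :=
  AffineSpace (ULift.{u} (Fin n)) A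

/-- The morphism of schemes `𝔸ⁿ_R ⟶ 𝔸ⁿ_R` defined by a polynomial endomorphism `f`: the `R`-morphism
whose `i`-th coordinate function is `fᵢ(x₁, …, xₙ)`. -/
noncomputable def PolyEnd.toSchemeHom {n : ℕ} {R : Type u} [CommRing R] (f : PolyEnd n R) :
    affSpace n (Spec (CommRingCat.of R)) ⟶ affSpace n (Spec (CommRingCat.of R)) :=
  AffineSpace.homOfVector (affSpace n (Spec (CommRingCat.of R)) ↘ Spec (CommRingCat.of R))
    fun i => MvPolynomial.eval₂
      ((Scheme.ΓSpecIso (CommRingCat.of R)).inv ≫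
        (affSpace n (Spec (CommRingCat.of R)) ↘ Spec (CommRingCat.of R)).appTop).hom
      (fun j => AffineSpace.coord (Spec (CommRingCat.of R)) (ULift.up j)) (f.comp i.down)

/-- A map `F : A(k) → Aut(𝔸ⁿ_k)` is a morphism if it is given by an `A`-automorphism `φ` of
`A × 𝔸ⁿ`, i.e. `φ(a, x) = (a, F(a)(x))` for every `k`-point `a` of `A`. -/
def IsMorphismToAut {n : ℕ} {k : Type u} [Field k] {A : Scheme.{u}}
    (π : A ⟶ Spec (CommRingCat.of k)) (F : KPoint π → PolyAut n k) : Prop :=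
  ∃ φ : affSpace n A ≅ affSpace n A,
    φ.hom ≫ (affSpace n A ↘ A) = (affSpace n A ↘ A) ∧
    ∀ a : KPoint π, AffineSpace.map (ULift.{u} (Fin n)) a.1 ≫ φ.hom =
      PolyEnd.toSchemeHom (F a).val ≫ AffineSpace.map (ULift.{u} (Fin n)) a.1

/-- The Zariski topology on `Aut(𝔸ⁿ_k)`: the finest topology for which all morphisms
`A → Aut(𝔸ⁿ_k)` from algebraic varieties are continuous (see `PolyAut.isClosed_iff`). -/
noncomputable instance PolyAut.instTopologicalSpace (n : ℕ) (k : Type u) [Field k] [IsAlgClosed k] :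
    TopologicalSpace (PolyAut n k) :=
  ⨆ (A : Scheme.{u}) (π : A ⟶ Spec (CommRingCat.of k)) (_ : IsAlgVariety k A π)
    (F : KPoint π → PolyAut n k) (_ : IsMorphismToAut π F),
    TopologicalSpace.coinduced F inferInstance

/-- A set is closed iff its preimage under every morphism from an algebraic variety is closed. -/
theorem PolyAut.isClosed_iff {n : ℕ} {k : Type u} [Field k] [IsAlgClosed k]
    (C : Set (PolyAut n k)) :
    IsClosed C ↔ ∀ (A : Scheme.{u}) (π : A ⟶ Spec (CommRingCat.of k)), IsAlgVariety k A π →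
      ∀ F : KPoint π → PolyAut n k, IsMorphismToAut π F → IsClosed (F ⁻¹' C) := by
  simp only [isClosed_iSup_iff, isClosed_coinduced]

end Topology

/-! ### Alternating words in two subgroups and growth of their powers -/

section ReducedWords

variable {G : Type*} [Group G]

/-! By the Jung–van der Kulk theorem (`mem_iSup_amalgamFactor`) an automorphism of the plane is a
product of affine and triangular maps, so it lies in both groups or is an alternating product of
letters, each in exactly one of them. The degree is multiplicative on alternating products
(`degree_mul_of_reducedWord`): affine letters have degree 1, triangular ones at least 2. Cyclic
reduction then gives a dichotomy (`degree_pow_dichotomy`). Either `f` is conjugate into one factor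
and the degrees of its powers never exceed deg f, or it is conjugate to a word with ends in
different factors and deg f^(m+1) ≥ 2^m deg f. Since deg f ≥ 1, boundedness, deg f² ≤ deg f, and deg
f^m ≤ deg f for all m are one and the same condition.

For closedness, a family is locally a polynomial endomorphism `g` over a ring of functions, so deg g
bounds the degree of every nearby member. If the member at `a` is not algebraic, some power has a
nonzero coefficient in degree above deg g. This coefficient stays nonzero near `a`, where the power
therefore exceeds the degree of the member itself.

Generation by affine and triangular maps is proved in every characteristic with exponential maps.
The second component `G` of an automorphism is invariant under a nontrivial one, and passing to top
forms for a weight gives a nontrivial one fixing the top form of `G` (`IsExpMap.exists_top`). A top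
form with several terms, one of them a power of y, has a factor z y^β - x^α, which is then invariant
too; this is impossible for coprime α, β ≥ 2 (`IsExpMap.trivial_of_binomial`). Hence α = 1 on the
relevant edge of the Newton polygon, and a triangular substitution lowers the degree. -/

/-- `s` lies in exactly one of two subgroups, namely in `H i`. -/
def IsLetter (H : Bool → Subgroup G) (i : Bool) (s : G) : Prop := s ∈ H i ∧ s ∉ H (!i)

/-- `f` is an alternating product of `n` letters from two subgroups, the first letter being in `H i`
and the last one in `H j`. -/
inductive ReducedWord (H : Bool → Subgroup G) : Bool → Bool → ℕ → G → Prop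
  | single {i : Bool} {s : G} : IsLetter H i s → ReducedWord H i i 1 s
  | cons {i j : Bool} {n : ℕ} {s w : G} :
      IsLetter H i s → ReducedWord H (!i) j n w → ReducedWord H i j (n + 1) (s * w)

variable {H : Bool → Subgroup G}

theorem IsLetter.mul_right {i : Bool} {s c : G} (hs : IsLetter H i s) (hc : ∀ i, c ∈ H i) :
    IsLetter H i (s * c) :=
  ⟨mul_mem hs.1 (hc i), fun h => hs.2 ((Subgroup.mul_mem_cancel_right _ (hc _)).1 h)⟩

theorem IsLetter.mul_left {i : Bool} {s c : G} (hs : IsLetter H i s) (hc : ∀ i, c ∈ H i) :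
    IsLetter H i (c * s) :=
  ⟨mul_mem (hc i) hs.1, fun h => hs.2 ((Subgroup.mul_mem_cancel_left _ (hc _)).1 h)⟩

theorem IsLetter.inv {i : Bool} {s : G} (hs : IsLetter H i s) : IsLetter H i s⁻¹ :=
  ⟨inv_mem hs.1, fun h => hs.2 (inv_mem_iff.1 h)⟩

theorem mem_or_isLetter {i : Bool} {s : G} (hs : s ∈ H i) :
    (∀ j, s ∈ H j) ∨ IsLetter H i s := by
  by_cases h : s ∈ H (!i)
  · left
    intro j
    cases i <;> cases j <;> assumption
  · exact Or.inr ⟨hs, h⟩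

namespace ReducedWord

theorem mul {i j l : Bool} {n m : ℕ} {f g : G} (hf : ReducedWord H i j n f)
    (hg : ReducedWord H (!j) l m g) : ReducedWord H i l (n + m) (f * g) := by
  induction hf with
  | single hs => rw [add_comm]; exact cons hs hg
  | cons hs _ ih =>
    rw [mul_assoc, add_right_comm]
    exact cons hs (ih hg)

theorem mul_right {i j : Bool} {n : ℕ} {f c : G} (hf : ReducedWord H i j n f)
    (hc : ∀ i, c ∈ H i) : ReducedWord H i j n (f * c) := by
  induction hf with
  | single hs => exact single (hs.mul_right hc)
  | cons hs _ ih => rw [mul_assoc]; exact cons hs ih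

theorem mul_left {i j : Bool} {n : ℕ} {f c : G} (hf : ReducedWord H i j n f)
    (hc : ∀ i, c ∈ H i) : ReducedWord H i j n (c * f) := by
  cases hf with
  | single hs => exact single (hs.mul_left hc)
  | cons hs hw => rw [← mul_assoc]; exact cons (hs.mul_left hc) hw

/-- Words are built from the front; cyclic reduction also needs the last letter. -/
theorem isLetter_or_exists_mul_last {i j : Bool} {n : ℕ} {f : G} (hf : ReducedWord H i j n f) :
    (i = j ∧ n = 1 ∧ IsLetter H i f) ∨
      ∃ w t m, f = w * t ∧ n = m + 1 ∧ ReducedWord H i (!j) m w ∧ IsLetter H j t := by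
  induction hf with
  | single hs => exact Or.inl ⟨rfl, rfl, hs⟩
  | @cons i j n s w hs hw ih =>
    right
    rcases ih with ⟨rfl, rfl, h⟩ | ⟨v, t, m, rfl, rfl, hv, ht⟩
    · exact ⟨s, w, 1, rfl, rfl, by simpa using single hs, h⟩
    · exact ⟨s * v, t, m + 1, (mul_assoc _ _ _).symm, rfl, cons hs hv, ht⟩

theorem exists_mul_left {i : Bool} {x f : G} (hx : x ∈ H i)
    (hf : (∀ i, f ∈ H i) ∨ ∃ i j n, ReducedWord H i j n f) :
    (∀ i, x * f ∈ H i) ∨ ∃ i j n, ReducedWord H i j n (x * f) := by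
  rcases mem_or_isLetter hx with hx | hx
  · rcases hf with hf | ⟨i, j, n, hf⟩
    · exact Or.inl fun i => mul_mem (hx i) (hf i)
    · exact Or.inr ⟨i, j, n, hf.mul_left hx⟩
  rcases hf with hf | ⟨i', j, n, hf⟩
  · exact Or.inr ⟨i, i, 1, single (hx.mul_right hf)⟩
  by_cases h : i' = !i
  · subst h
    exact Or.inr ⟨i, j, _, cons hx hf⟩
  obtain rfl : i' = i := by cases i <;> cases i' <;> simp_all
  cases hf with
  | single hs =>
    rcases mem_or_isLetter (mul_mem hx.1 hs.1) with h | h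
    · exact Or.inl h
    · exact Or.inr ⟨_, _, _, single h⟩
  | cons hs hw =>
    rw [← mul_assoc]
    rcases mem_or_isLetter (mul_mem hx.1 hs.1) with h | h
    · exact Or.inr ⟨_, _, _, hw.mul_left h⟩
    · exact Or.inr ⟨_, _, _, cons h hw⟩

theorem exists_of_mem_iSup {f : G} (hf : f ∈ ⨆ i, H i) :
    (∀ i, f ∈ H i) ∨ ∃ i j n, ReducedWord H i j n f := by
  rw [Subgroup.iSup_eq_closure] at hf
  induction hf using Subgroup.closure_induction_left with
  | one => exact Or.inl fun i => one_mem _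
  | mul_left x hx y _ ih =>
    obtain ⟨i, hx⟩ := Set.mem_iUnion.1 hx
    exact exists_mul_left hx ih
  | inv_mul_cancel x hx y _ ih =>
    obtain ⟨i, hx⟩ := Set.mem_iUnion.1 hx
    exact exists_mul_left (inv_mem hx) ih

/-- Let `d` be submultiplicative on a group, and multiplicative on reduced words. Then the powers of
a reduced word `f` either do not exceed `f` or grow exponentially. -/
theorem pow_le_or_le_pow {d : G → ℕ}
    (hle : ∀ f g, d (f * g) ≤ d f * d g)
    (hmul : ∀ {i j l n m f g}, ReducedWord H i j n f → ReducedWord H (!j) l m g →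
      d (f * g) = d f * d g)
    (hpos : ∀ {i j n f}, ReducedWord H i j n f → 1 ≤ d f)
    (htrue : ∀ {s}, IsLetter H true s → 2 ≤ d s)
    (hpow : ∀ i, ∀ s ∈ H i, ∀ m, d (s ^ (m + 1)) ≤ d s)
    (n : ℕ) {i j : Bool} {f : G} (hf : ReducedWord H i j n f) :
    (∀ m, d (f ^ (m + 1)) ≤ d f) ∨
      ∀ m, (∃ l, ReducedWord H i j l (f ^ (m + 1))) ∧ 2 ^ m * d f ≤ d (f ^ (m + 1)) := by
  -- When the ends lie in different factors, one of them is a letter of `H true` and contributes a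
  -- factor of at least 2.
  have htwo : ∀ {i n f}, ReducedWord H i (!i) n f → 2 ≤ d f := by
    intro i n f hf
    cases hi : i with
    | true =>
      subst hi
      generalize hj : (!true) = j at hf
      cases hf with
      | single hs => exact htrue hs
      | cons hs hw =>
        rw [hmul (single hs) hw]
        exact le_trans (htrue hs) (Nat.le_mul_of_pos_right _ (hpos hw))
    | false =>
      subst hi
      rcases hf.isLetter_or_exists_mul_last with ⟨h, -⟩ | ⟨w, t, m, rfl, -, hw, ht⟩
      · exact absurd h (by decide)
      · rw [hmul hw (by simpa using single ht)]
        exact le_trans (htrue ht) (Nat.le_mul_of_pos_left _ (hpos hw))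
  induction n using Nat.strong_induction_on generalizing i j f with
  | _ n ih =>
  -- With ends in different factors, copies of `f` concatenate without cancellation.
  by_cases hij : j = !i
  · subst hij
    right
    intro m
    induction m with
    | zero => simpa using ⟨n, hf⟩
    | succ m ihm =>
      obtain ⟨⟨l, hl⟩, hm⟩ := ihm
      have hf' : ReducedWord H (!!i) (!i) n f := by simpa using hf
      refine ⟨⟨_, by rw [pow_succ]; exact hl.mul hf'⟩, ?_⟩
      rw [pow_succ f, hmul hl hf']
      have := htwo hf
      calc 2 ^ (m + 1) * d f = 2 ^ m * d f * 2 := by ring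
        _ ≤ _ := Nat.mul_le_mul hm this
  obtain rfl : j = i := by cases i <;> cases j <;> simp_all
  cases hf with
  | single hs => exact Or.inl (hpow _ _ hs.1)
  | @cons _ _ n s w hs hw =>
  rcases hw.isLetter_or_exists_mul_last with ⟨h, -⟩ | ⟨v, t, l, rfl, rfl, hv, ht⟩
  · simp at h
  -- Here f = s v t with `s` and `t` in the same factor, and consecutive copies of `f` meet in `t *
  -- s`. If this lies in both factors, f = s (v t s) s⁻¹ with a shorter word inside, and the
  -- dichotomy is transported along this conjugation.
  rcases mem_or_isLetter (mul_mem ht.1 hs.1) with hc | hc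
  · have hvc := hv.mul_right hc
    have hconj : s * (v * t) = s * (v * (t * s)) * s⁻¹ := by group
    have hred : ∀ {l h}, ReducedWord H (!j) (!j) l h →
        (∃ n, ReducedWord H j j n (s * h * s⁻¹)) ∧ d (s * h * s⁻¹) = d s * d h * d s⁻¹ := by
      intro l h hh
      have h1 := cons hs hh
      have h2 : ReducedWord H (!!j) j 1 s⁻¹ := by simpa using single hs.inv
      exact ⟨⟨_, h1.mul h2⟩, by rw [hmul h1 h2, hmul (single hs) hh]⟩
    rw [hconj]
    simp only [conj_pow]
    rw [(hred hvc).2]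
    rcases ih l (by omega) hvc with h | h
    · left
      intro m
      exact (hle _ _).trans (Nat.mul_le_mul_right _ ((hle _ _).trans (Nat.mul_le_mul_left _ (h m))))
    · right
      intro m
      -- Reducedness of the powers is carried in the induction because the lower bound needs exact
      -- multiplicativity on the conjugate.
      obtain ⟨⟨l', hl'⟩, hm⟩ := h m
      refine ⟨(hred hl').1, ?_⟩
      rw [(hred hl').2]
      calc 2 ^ m * (d s * d (v * (t * s)) * d s⁻¹)
          = d s * (2 ^ m * d (v * (t * s))) * d s⁻¹ := by ring
        _ ≤ _ := Nat.mul_le_mul_right _ (Nat.mul_le_mul_left _ hm)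
  · right
    have hvt : ReducedWord H (!j) j (l + 1) (v * t) := hv.mul (by simpa using single ht)
    have hvc : ReducedWord H (!j) j (l + 1) (v * (t * s)) := hv.mul (by simpa using single hc)
    have h2 : 2 ≤ d (v * (t * s)) := htwo (i := !j) (by simpa using hvc)
    -- Now f^(m+1) = s (v t s)^m (v t), and v t s has its ends in different factors, so every copy
    -- gains a factor of at least 2.
    have key : ∀ m, (∃ l', ReducedWord H (!j) j l' ((v * (t * s)) ^ m * (v * t))) ∧
        2 ^ m * d (v * t) ≤ d ((v * (t * s)) ^ m * (v * t)) := by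
      intro m
      induction m with
      | zero => simpa using ⟨_, hvt⟩
      | succ m ihm =>
        obtain ⟨⟨l', hl'⟩, hm⟩ := ihm
        rw [pow_succ', mul_assoc (v * (t * s))]
        refine ⟨⟨_, hvc.mul hl'⟩, ?_⟩
        rw [hmul hvc hl']
        calc 2 ^ (m + 1) * d (v * t) = 2 * (2 ^ m * d (v * t)) := by ring
          _ ≤ _ := Nat.mul_le_mul h2 hm
    have hpw : ∀ m, (s * (v * t)) ^ (m + 1) = s * ((v * (t * s)) ^ m * (v * t)) := by
      intro m
      induction m with
      | zero => simp
      | succ m ihm => rw [pow_succ, ihm, pow_succ (v * (t * s))]; group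
    intro m
    obtain ⟨⟨l', hl'⟩, hm⟩ := key m
    rw [hpw]
    refine ⟨⟨_, cons hs hl'⟩, ?_⟩
    rw [hmul (single hs) hl', hmul (single hs) hvt, mul_left_comm]
    exact Nat.mul_le_mul_left _ hm

end ReducedWord

end ReducedWords

/-! ### Total degree under substitution -/

section Degree

open MvPolynomial

theorem MvPolynomial.totalDegree_bind₁_le {σ τ R : Type*} [CommRing R] (g : σ → MvPolynomial τ R)
    {D : ℕ} (hg : ∀ i, (g i).totalDegree ≤ D) (p : MvPolynomial σ R) :
    (bind₁ g p).totalDegree ≤ p.totalDegree * D := by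
  conv_lhs => rw [p.as_sum, map_sum]
  refine totalDegree_finsetSum_le fun m hm => ?_
  rw [bind₁_monomial]
  refine (totalDegree_mul _ _).trans ?_
  rw [totalDegree_C, zero_add]
  refine (totalDegree_finsetProd _ _).trans ?_
  calc ∑ i ∈ m.support, (g i ^ m i).totalDegree ≤ ∑ i ∈ m.support, m i * D :=
        Finset.sum_le_sum fun i _ =>
          (totalDegree_pow _ _).trans (Nat.mul_le_mul_left _ (hg i))
    _ = (m.sum fun _ e => e) * D := by rw [← Finset.sum_mul]; rfl
    _ ≤ _ := Nat.mul_le_mul_right _ (le_totalDegree hm)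

theorem MvPolynomial.totalDegree_pow_of_isDomain {σ R : Type*} [CommRing R] [IsDomain R]
    (p : MvPolynomial σ R) (n : ℕ) : (p ^ n).totalDegree = n * p.totalDegree := by
  rcases eq_or_ne p 0 with rfl | hp
  · rcases n with _ | n <;> simp
  induction n with
  | zero => simp
  | succ n ih =>
    rw [pow_succ, totalDegree_mul_of_isDomain (pow_ne_zero _ hp) hp, ih]
    ring

theorem MvPolynomial.totalDegree_C_mul_of_ne_zero {σ k : Type*} [Field k] {a : k} (ha : a ≠ 0)
    (p : MvPolynomial σ k) : (C a * p).totalDegree = p.totalDegree := by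
  rcases eq_or_ne p 0 with rfl | hp
  · simp
  rw [totalDegree_mul_of_isDomain (by simpa using ha) hp, totalDegree_C, zero_add]

/-- For nonconstant `q` the leading term strictly dominates the others; for constant `q` both sides
vanish. -/
theorem MvPolynomial.totalDegree_aeval_polynomial {σ k : Type*} [Field k] (q : MvPolynomial σ k)
    (P : Polynomial k) : (Polynomial.aeval q P).totalDegree = P.natDegree * q.totalDegree := by
  rcases Nat.eq_zero_or_pos q.totalDegree with h0 | hq
  · rw [totalDegree_eq_zero_iff_eq_C.1 h0, ← MvPolynomial.algebraMap_eq,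
      Polynomial.aeval_algebraMap_apply, MvPolynomial.algebraMap_eq]
    simp
  induction hn : P.natDegree using Nat.strong_induction_on generalizing P with
  | _ n ih =>
  rcases Nat.eq_zero_or_pos n with rfl | hpos
  · rw [Polynomial.eq_C_of_natDegree_eq_zero hn, Polynomial.aeval_C, MvPolynomial.algebraMap_eq]
    simp
  have hP : P ≠ 0 := by rintro rfl; simp at hn; omega
  have hlead : (Polynomial.aeval q (Polynomial.monomial P.natDegree P.leadingCoeff)).totalDegree =
      n * q.totalDegree := by
    rw [Polynomial.aeval_monomial, MvPolynomial.algebraMap_eq,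
      totalDegree_C_mul_of_ne_zero (by simpa using hP), totalDegree_pow_of_isDomain, hn]
  rw [← P.eraseLead_add_monomial_natDegree_leadingCoeff, map_add,
    totalDegree_add_eq_right_of_totalDegree_lt, hlead]
  have hlt : P.eraseLead.natDegree < n := by
    have := P.eraseLead_natDegree_le
    omega
  rw [hlead, ih _ hlt _ rfl]
  exact Nat.mul_lt_mul_of_pos_right hlt hq

theorem MvPolynomial.eq_of_totalDegree_le_one {R : Type*} [CommRing R]
    {p : MvPolynomial (Fin 2) R} (hp : p.totalDegree ≤ 1) :
    ∃ a b c, p = C a * X 0 + C b * X 1 + C c := by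
  refine ⟨p.coeff (Finsupp.single 0 1), p.coeff (Finsupp.single 1 1), p.coeff 0, ?_⟩
  ext m
  by_cases hm : 1 < m 0 + m 1
  · rw [coeff_eq_zero_of_totalDegree_lt]
    · simp only [coeff_add, coeff_C_mul, coeff_X, coeff_C]
      rw [if_neg, if_neg, if_neg]
      · simp
      · rintro rfl; simp at hm
      · rintro rfl; simp at hm
      · rintro rfl; simp at hm
    · refine hp.trans_lt ?_
      rw [← Finsupp.degree_apply, Finsupp.degree_eq_sum, Fin.sum_univ_two]
      exact hm
  · have : m = 0 ∨ m = Finsupp.single 0 1 ∨ m = Finsupp.single 1 1 := by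
      rcases Nat.eq_zero_or_pos (m 0) with h0 | h0
      · rcases Nat.eq_zero_or_pos (m 1) with h1 | h1
        · left; ext i; fin_cases i <;> simp [h0, h1]
        · right; right; ext i; fin_cases i
          · simp [h0]
          · simp; omega
      · right; left; ext i; fin_cases i
        · simp; omega
        · simp; omega
    have hne (i : Fin 2) : (0 : Fin 2 →₀ ℕ) ≠ Finsupp.single i 1 :=
      (Finsupp.single_ne_zero.2 one_ne_zero).symm
    rcases this with rfl | rfl | rfl <;>
      simp [coeff_X, coeff_C, Finsupp.single_eq_single_iff, hne]

end Degree

/-! ### Affine and triangular automorphisms, multiplicativity of the degree -/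

namespace PolyEnd

open MvPolynomial

theorem totalDegree_le_degree {n : ℕ} {R : Type u} [CommRing R] (f : PolyEnd n R) (i : Fin n) :
    (f.comp i).totalDegree ≤ f.degree :=
  Finset.le_sup (f := fun i => (f.comp i).totalDegree) (Finset.mem_univ i)

theorem degree_le_iff {n : ℕ} {R : Type u} [CommRing R] (f : PolyEnd n R) (D : ℕ) :
    f.degree ≤ D ↔ ∀ i, (f.comp i).totalDegree ≤ D := by
  simp [degree]

theorem degree_mul_le {n : ℕ} {R : Type u} [CommRing R] (f g : PolyEnd n R) :
    (f * g).degree ≤ f.degree * g.degree :=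
  (degree_le_iff _ _).2 fun i => (totalDegree_bind₁_le _ g.totalDegree_le_degree _).trans
    (Nat.mul_le_mul_right _ (f.totalDegree_le_degree i))

end PolyEnd

namespace PolyAut

open MvPolynomial

theorem degree_mul_le {n : ℕ} {R : Type u} [CommRing R] (f g : PolyAut n R) :
    degree (f * g) ≤ degree f * degree g :=
  PolyEnd.degree_mul_le _ _

theorem degree_one {k : Type u} [Field k] : degree (1 : PolyAut 2 k) = 1 := by
  simp [degree, PolyEnd.degree, PolyEnd.one_comp, Fin.univ_succ]

theorem one_le_degree {k : Type u} [Field k] (f : PolyAut 2 k) : 1 ≤ degree f := by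
  by_contra h
  have := degree_mul_le f f⁻¹
  rw [mul_inv_cancel, degree_one] at this
  simp_all

/-- The affine automorphisms. -/
def affineSubgroup (k : Type u) [Field k] : Subgroup (PolyAut 2 k) where
  carrier := {f | degree f ≤ 1 ∧ degree f⁻¹ ≤ 1}
  one_mem' := by simp [degree_one]
  mul_mem' {f g} hf hg := by
    refine ⟨(degree_mul_le _ _).trans (mul_le_one' hf.1 hg.1), ?_⟩
    rw [mul_inv_rev]
    exact (degree_mul_le _ _).trans (mul_le_one' hg.2 hf.2)
  inv_mem' {f} hf := by
    rw [Set.mem_ofPred_eq, inv_inv]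
    exact ⟨hf.2, hf.1⟩

end PolyAut

/-- The endomorphism `(a x + P(y), b y + c)`. -/
noncomputable def PolyEnd.triangular {k : Type u} [Field k] (a b : k) (P : Polynomial k) (c : k) :
    PolyEnd 2 k :=
  ⟨![MvPolynomial.C a * MvPolynomial.X 0 + Polynomial.aeval (MvPolynomial.X 1) P,
    MvPolynomial.C b * MvPolynomial.X 1 + MvPolynomial.C c]⟩

namespace PolyEnd

variable {k : Type u} [Field k]

open MvPolynomial

theorem triangular_mul_comp_zero (a b : k) (P : Polynomial k) (c : k) (g : PolyEnd 2 k) :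
    (triangular a b P c * g).comp 0 = C a * g.comp 0 + Polynomial.aeval (g.comp 1) P := by
  simp [mul_comp, triangular, ← Polynomial.aeval_algHom_apply]

theorem triangular_mul_comp_one (a b : k) (P : Polynomial k) (c : k) (g : PolyEnd 2 k) :
    (triangular a b P c * g).comp 1 = C b * g.comp 1 + C c := by
  simp [mul_comp, triangular]

theorem triangular_mul (a b : k) (P : Polynomial k) (c a' b' : k) (P' : Polynomial k) (c' : k) :
    triangular a b P c * triangular a' b' P' c' =
      triangular (a * a') (b * b') (Polynomial.C a * P' +
        P.comp (Polynomial.C b' * Polynomial.X + Polynomial.C c')) (b * c' + c) := by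
  ext1
  funext i
  fin_cases i
  · change (triangular a b P c * triangular a' b' P' c').comp 0 = _
    rw [triangular_mul_comp_zero]
    simp [triangular, Polynomial.aeval_comp, MvPolynomial.algebraMap_eq]
    ring
  · change (triangular a b P c * triangular a' b' P' c').comp 1 = _
    rw [triangular_mul_comp_one]
    simp [triangular]
    ring

theorem triangular_one : triangular (1 : k) 1 0 0 = 1 := by
  ext1
  funext i
  fin_cases i <;> simp [triangular, one_comp]

end PolyEnd

namespace PolyAut

variable {k : Type u} [Field k]

open MvPolynomial

/-- The automorphism `(a x + P(y), b y + c)`. -/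
noncomputable def triangular (a b : kˣ) (P : Polynomial k) (c : k) : PolyAut 2 k where
  val := PolyEnd.triangular a b P c
  inv := PolyEnd.triangular (a⁻¹ : kˣ) (b⁻¹ : kˣ) (-Polynomial.C ((a⁻¹ : kˣ) : k) *
    P.comp (Polynomial.C ((b⁻¹ : kˣ) : k) * Polynomial.X + Polynomial.C (-((b⁻¹ : kˣ) : k) * c)))
    (-((b⁻¹ : kˣ) : k) * c)
  val_inv := by
    rw [PolyEnd.triangular_mul, ← PolyEnd.triangular_one]
    congr 1
    · simp
    · simp
    · rw [← mul_assoc, mul_neg, ← Polynomial.C_mul]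
      simp
    · simp
  inv_val := by
    rw [PolyEnd.triangular_mul, ← PolyEnd.triangular_one]
    congr 1
    · simp
    · simp
    · simp only [Polynomial.mul_comp, Polynomial.neg_comp, Polynomial.C_comp, Polynomial.comp_assoc,
        Polynomial.add_comp, Polynomial.X_comp]
      have : Polynomial.C ((b⁻¹ : kˣ) : k) *
          (Polynomial.C (b : k) * Polynomial.X + Polynomial.C c) +
          Polynomial.C (-((b⁻¹ : kˣ) : k) * c) = Polynomial.X := by
        rw [mul_add, ← mul_assoc, ← Polynomial.C_mul, ← Polynomial.C_mul]
        simp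
      rw [this]
      simp
    · simp

theorem triangular_val (a b : kˣ) (P : Polynomial k) (c : k) :
    (triangular a b P c).val = PolyEnd.triangular (a : k) (b : k) P c := rfl

theorem triangular_mul (a b : kˣ) (P : Polynomial k) (c : k) (a' b' : kˣ) (P' : Polynomial k)
    (c' : k) :
    triangular a b P c * triangular a' b' P' c' =
      triangular (a * a') (b * b') (Polynomial.C (a : k) * P' +
        P.comp (Polynomial.C (b' : k) * Polynomial.X + Polynomial.C c')) (b * c' + c) :=
  Units.ext (PolyEnd.triangular_mul _ _ _ _ _ _ _ _)

theorem triangular_one : triangular (1 : kˣ) 1 0 0 = 1 :=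
  Units.ext PolyEnd.triangular_one

theorem triangular_inv (a b : kˣ) (P : Polynomial k) (c : k) :
    (triangular a b P c)⁻¹ = triangular a⁻¹ b⁻¹ (-Polynomial.C ((a⁻¹ : kˣ) : k) *
    P.comp (Polynomial.C ((b⁻¹ : kˣ) : k) * Polynomial.X + Polynomial.C (-((b⁻¹ : kˣ) : k) * c)))
    (-((b⁻¹ : kˣ) : k) * c) := Units.ext rfl

/-- The triangular automorphisms. -/
def triangularSubgroup (k : Type u) [Field k] : Subgroup (PolyAut 2 k) where
  carrier := {f | ∃ a b P c, f = triangular a b P c}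
  one_mem' := ⟨_, _, _, _, triangular_one.symm⟩
  mul_mem' := by
    rintro _ _ ⟨a, b, P, c, rfl⟩ ⟨a', b', P', c', rfl⟩
    exact ⟨_, _, _, _, triangular_mul _ _ _ _ _ _ _ _⟩
  inv_mem' := by
    rintro _ ⟨a, b, P, c, rfl⟩
    exact ⟨_, _, _, _, triangular_inv _ _ _ _⟩

theorem mem_triangularSubgroup {f : PolyAut 2 k} :
    f ∈ triangularSubgroup k ↔ ∃ a b P c, f = triangular a b P c := Iff.rfl

theorem degree_eq_max (f : PolyAut 2 k) :
    degree f = max (f.val.comp 0).totalDegree (f.val.comp 1).totalDegree := by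
  simp [degree, PolyEnd.degree, Fin.univ_succ]

theorem degree_triangular_le (a b : kˣ) (P : Polynomial k) (c : k) :
    degree (triangular a b P c) ≤ max 1 P.natDegree := by
  rw [degree_eq_max]
  simp only [triangular_val, PolyEnd.triangular, Matrix.cons_val_zero, Matrix.cons_val_one]
  refine max_le ((totalDegree_add _ _).trans (max_le_max ?_ ?_))
    ((totalDegree_add _ _).trans (max_le (le_max_of_le_left ?_) ?_))
  · rw [totalDegree_C_mul_of_ne_zero a.ne_zero, totalDegree_X]
  · rw [totalDegree_aeval_polynomial, totalDegree_X, mul_one]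
  · rw [totalDegree_C_mul_of_ne_zero b.ne_zero, totalDegree_X]
  · simp

/-- `P` of the second component of `w` has degree at least 2 deg w, so it swamps the multiple of the
first component. -/
theorem totalDegree_triangular_mul_comp_zero (a b : kˣ) {P : Polynomial k} (hP : 2 ≤ P.natDegree)
    (c : k) (w : PolyAut 2 k) (hw : (w.val.comp 1).totalDegree = degree w) :
    ((triangular a b P c * w).val.comp 0).totalDegree = P.natDegree * degree w := by
  have h1 := one_le_degree w
  rw [Units.val_mul, triangular_val, PolyEnd.triangular_mul_comp_zero,
    totalDegree_add_eq_right_of_totalDegree_lt, totalDegree_aeval_polynomial, hw]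
  rw [totalDegree_aeval_polynomial, hw, totalDegree_C_mul_of_ne_zero a.ne_zero]
  have := w.val.totalDegree_le_degree 0
  change _ ≤ degree w at this
  nlinarith

theorem totalDegree_triangular_mul_comp_one (a b : kˣ) (P : Polynomial k)
    (c : k) (w : PolyAut 2 k) :
    ((triangular a b P c * w).val.comp 1).totalDegree ≤ degree w := by
  rw [Units.val_mul, triangular_val, PolyEnd.triangular_mul_comp_one]
  refine (totalDegree_add _ _).trans (max_le ?_ (by simp))
  rw [totalDegree_C_mul_of_ne_zero b.ne_zero]
  exact w.val.totalDegree_le_degree 1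

theorem degree_triangular_mul (a b : kˣ) {P : Polynomial k} (hP : 2 ≤ P.natDegree)
    (c : k) (w : PolyAut 2 k) (hw : (w.val.comp 1).totalDegree = degree w) :
    degree (triangular a b P c * w) = P.natDegree * degree w := by
  have h1 := one_le_degree w
  rw [degree_eq_max, totalDegree_triangular_mul_comp_zero a b hP c w hw, max_eq_left]
  exact (totalDegree_triangular_mul_comp_one _ _ _ _ _).trans (by nlinarith)

theorem totalDegree_one_comp : ((1 : PolyAut 2 k).val.comp 1).totalDegree =
    degree (1 : PolyAut 2 k) := by
  rw [degree_one]
  exact totalDegree_X _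

theorem degree_triangular (a b : kˣ) (P : Polynomial k) (c : k) :
    degree (triangular a b P c) = max 1 P.natDegree := by
  refine le_antisymm (degree_triangular_le _ _ _ _) (max_le (one_le_degree _) ?_)
  by_cases hP : 2 ≤ P.natDegree
  · have := degree_triangular_mul a b hP c 1 totalDegree_one_comp
    rw [mul_one, degree_one, mul_one] at this
    exact this.ge
  · exact le_trans (by omega) (one_le_degree _)

theorem natDegree_comp_linear_le (P : Polynomial k) (b c : k) :
    (P.comp (Polynomial.C b * Polynomial.X + Polynomial.C c)).natDegree ≤ P.natDegree :=
  Polynomial.natDegree_comp_le.trans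
    ((Nat.mul_le_mul_left _ Polynomial.natDegree_linear_le).trans (mul_one _).le)

theorem triangular_mem_affineSubgroup (a b : kˣ) {P : Polynomial k} (hP : P.natDegree ≤ 1) (c : k) :
    triangular a b P c ∈ affineSubgroup k := by
  refine ⟨?_, ?_⟩
  · rw [degree_triangular]
    exact max_le le_rfl hP
  · rw [triangular_inv, degree_triangular, ← Polynomial.C_neg]
    exact max_le le_rfl ((Polynomial.natDegree_C_mul_le _ _).trans
      ((natDegree_comp_linear_le _ _ _).trans hP))

theorem degree_triangular_pow_le (a b : kˣ) (P : Polynomial k) (c : k) (m : ℕ) :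
    ∃ a' b' P' c', triangular a b P c ^ m = triangular a' b' P' c' ∧
      P'.natDegree ≤ P.natDegree := by
  induction m with
  | zero => exact ⟨1, 1, 0, 0, by rw [pow_zero, triangular_one], by simp⟩
  | succ m ih =>
    obtain ⟨a', b', P', c', h, hP⟩ := ih
    rw [pow_succ', h, triangular_mul]
    exact ⟨_, _, _, _, rfl, (Polynomial.natDegree_add_le _ _).trans (max_le
      ((Polynomial.natDegree_C_mul_le _ _).trans hP) (natDegree_comp_linear_le _ _ _))⟩

theorem degree_pow_le_of_mem_affineSubgroup {f : PolyAut 2 k} (hf : f ∈ affineSubgroup k) (m : ℕ) :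
    degree (f ^ m) ≤ degree f :=
  (pow_mem hf m).1.trans (one_le_degree f)

theorem degree_pow_le_of_mem_triangularSubgroup {f : PolyAut 2 k} (hf : f ∈ triangularSubgroup k)
    (m : ℕ) : degree (f ^ m) ≤ degree f := by
  obtain ⟨a, b, P, c, rfl⟩ := hf
  obtain ⟨a', b', P', c', h, hP⟩ := degree_triangular_pow_le a b P c m
  rw [h, degree_triangular, degree_triangular]
  exact max_le_max le_rfl hP

/-- Submultiplicativity, applied to `a` and to `a⁻¹`. -/
theorem degree_affine_mul {a : PolyAut 2 k} (ha : a ∈ affineSubgroup k) (w : PolyAut 2 k) :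
    degree (a * w) = degree w := by
  refine le_antisymm ?_ ?_
  · exact (degree_mul_le _ _).trans (by simpa using Nat.mul_le_mul_right (degree w) ha.1)
  · have := degree_mul_le a⁻¹ (a * w)
    rw [inv_mul_cancel_left] at this
    exact this.trans (by simpa using Nat.mul_le_mul_right (degree (a * w)) ha.2)

/-- Without an x-term in the second component the Jacobian is a constant p d, nonzero by
invertibility, and `a` would be triangular. -/
theorem affine_comp_one {a : PolyAut 2 k} (ha : a ∈ affineSubgroup k)
    (ht : a ∉ triangularSubgroup k) :
    ∃ c d e : k, c ≠ 0 ∧ a.val.comp 1 = C c * X 0 + C d * X 1 + C e := by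
  obtain ⟨p, q, r, h0⟩ := eq_of_totalDegree_le_one ((a.val.totalDegree_le_degree 0).trans ha.1)
  obtain ⟨c, d, e, h1⟩ := eq_of_totalDegree_le_one ((a.val.totalDegree_le_degree 1).trans ha.1)
  refine ⟨c, d, e, ?_, h1⟩
  rintro rfl
  have hj : a.val.jac = C (p * d) := by
    rw [PolyEnd.jac, Matrix.det_fin_two]
    simp [PolyEnd.jacMatrix, h0, h1, pderiv_X]
  have hu := PolyEnd.jac_mul a.val a.inv
  rw [a.val_inv, PolyEnd.jac_one, hj, MvPolynomial.bind₁_C_right] at hu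
  have hpd : p * d ≠ 0 := by
    intro h
    rw [h] at hu
    simp at hu
  refine ht ⟨Units.mk0 p (left_ne_zero_of_mul hpd), Units.mk0 d (right_ne_zero_of_mul hpd),
    Polynomial.C q * Polynomial.X + Polynomial.C r, e, Units.ext ?_⟩
  ext1
  funext i
  fin_cases i
  · simp [triangular_val, PolyEnd.triangular, h0, MvPolynomial.algebraMap_eq, add_assoc]
  · simp [triangular_val, PolyEnd.triangular, h1]

/-- The affine and the triangular subgroup. -/
def amalgamFactor (k : Type u) [Field k] : Bool → Subgroup (PolyAut 2 k)
  | true => triangularSubgroup k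
  | false => affineSubgroup k

/-- The first letter of a reduced word is detected by the degrees of the components. -/
def DegreePattern : Bool → PolyAut 2 k → Prop
  | true, w => (w.val.comp 0).totalDegree = degree w ∧ (w.val.comp 1).totalDegree < degree w
  | false, w => (w.val.comp 1).totalDegree = degree w

/-- Ping-pong on degrees: a triangular letter turns full degree of the second component into strict
dominance of the first, and an affine letter, having x in its second component, carries a dominant
first component over to the second. -/
theorem degree_letter_mul {i : Bool} {s w : PolyAut 2 k} (hs : IsLetter (amalgamFactor k) i s)
    (hw : DegreePattern (!i) w) :
    degree (s * w) = degree s * degree w ∧ DegreePattern i (s * w) := by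
  cases i with
  | true =>
    obtain ⟨⟨a, b, P, c, rfl⟩, hs⟩ := hs
    have hP : 2 ≤ P.natDegree := by
      by_contra h
      exact hs (triangular_mem_affineSubgroup a b (by omega) c)
    have h1 := one_le_degree w
    have h2 := degree_triangular_mul a b hP c w hw
    rw [degree_triangular, max_eq_right (by omega)]
    refine ⟨h2, ?_, ?_⟩
    · rw [h2, totalDegree_triangular_mul_comp_zero a b hP c w hw]
    · rw [h2]
      exact (totalDegree_triangular_mul_comp_one _ _ _ _ _).trans_lt (by nlinarith)
  | false =>
    obtain ⟨c, d, e, hc, h⟩ := affine_comp_one hs.1 hs.2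
    have hs1 : degree s = 1 := le_antisymm hs.1.1 (one_le_degree s)
    refine ⟨by rw [degree_affine_mul hs.1, hs1, one_mul], ?_⟩
    obtain ⟨hw0, hw1⟩ := hw
    have hw0' : (C c * w.val.comp 0).totalDegree = degree w := by
      rw [totalDegree_C_mul_of_ne_zero hc, hw0]
    have hlt : (C d * w.val.comp 1 + C e).totalDegree < degree w := by
      refine (totalDegree_add _ _).trans_lt (max_lt ?_ ?_)
      · exact (totalDegree_mul _ _).trans_lt (by simpa using hw1)
      · rw [totalDegree_C]; exact one_le_degree w
    have hcomp : (s * w).val.comp 1 = C c * w.val.comp 0 + (C d * w.val.comp 1 + C e) := by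
      rw [Units.val_mul, PolyEnd.mul_comp, h]
      simp [add_assoc]
    change ((s * w).val.comp 1).totalDegree = _
    rw [degree_affine_mul hs.1, hcomp, totalDegree_add_eq_left_of_totalDegree_lt] <;> rw [hw0']
    exact hlt

theorem degreePattern_of_isLetter {i : Bool} {s : PolyAut 2 k}
    (hs : IsLetter (amalgamFactor k) i s) : DegreePattern i s := by
  cases i with
  -- The identity has the pattern required of a word following a triangular letter.
  | true => simpa using (degree_letter_mul hs (w := 1) totalDegree_one_comp).2
  | false =>
    obtain ⟨c, d, e, hc, h⟩ := affine_comp_one hs.1 hs.2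
    refine le_antisymm (s.val.totalDegree_le_degree 1) (hs.1.1.trans ?_)
    refine le_trans ?_ (le_totalDegree (s := Finsupp.single 0 1) ?_)
    · simp
    · rw [h, mem_support_iff]
      have hne : (0 : Fin 2 →₀ ℕ) ≠ Finsupp.single 0 1 :=
        (Finsupp.single_ne_zero.2 one_ne_zero).symm
      simpa [coeff_X, coeff_C, Finsupp.single_eq_single_iff, hne] using hc

theorem degreePattern_of_reducedWord {i j : Bool} {n : ℕ} {w : PolyAut 2 k}
    (hw : ReducedWord (amalgamFactor k) i j n w) : DegreePattern i w := by
  induction hw with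
  | single hs => exact degreePattern_of_isLetter hs
  | cons hs _ ih => exact (degree_letter_mul hs ih).2

theorem degree_mul_of_reducedWord {i j l : Bool} {n m : ℕ} {f g : PolyAut 2 k}
    (hf : ReducedWord (amalgamFactor k) i j n f) (hg : ReducedWord (amalgamFactor k) (!j) l m g) :
    degree (f * g) = degree f * degree g := by
  induction hf with
  | single hs => exact (degree_letter_mul hs (degreePattern_of_reducedWord hg)).1
  | cons hs hw ih =>
    rw [mul_assoc, (degree_letter_mul hs (degreePattern_of_reducedWord (hw.mul hg))).1, ih hg,
      (degree_letter_mul hs (degreePattern_of_reducedWord hw)).1, mul_assoc]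

/-- The powers of an element of the subgroup generated by the affine and the triangular
automorphisms either do not exceed its degree, or have exponentially growing degree. -/
theorem degree_pow_dichotomy {f : PolyAut 2 k} (hf : f ∈ ⨆ i, amalgamFactor k i) :
    (∀ m, degree (f ^ (m + 1)) ≤ degree f) ∨ ∀ m, 2 ^ m * degree f ≤ degree (f ^ (m + 1)) := by
  have hpow : ∀ i, ∀ s ∈ amalgamFactor k i, ∀ m, degree (s ^ (m + 1)) ≤ degree s := by
    intro i s hs m
    cases i with
    | true => exact degree_pow_le_of_mem_triangularSubgroup hs _
    | false => exact degree_pow_le_of_mem_affineSubgroup hs _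
  rcases ReducedWord.exists_of_mem_iSup hf with h | ⟨i, j, n, h⟩
  · exact Or.inl (hpow true f (h true))
  have htrue : ∀ {s}, IsLetter (amalgamFactor k) true s → 2 ≤ degree s := by
    rintro s ⟨⟨a, b, P, c, rfl⟩, hs⟩
    rw [degree_triangular]
    by_contra h
    exact hs (triangular_mem_affineSubgroup a b (by simp at h; omega) c)
  exact (ReducedWord.pow_le_or_le_pow degree_mul_le degree_mul_of_reducedWord
    (fun _ => one_le_degree _) htrue hpow n h).imp_right fun h m => (h m).2

end PolyAut

/-! ### Exponential maps and their invariants -/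

section ExponentialMaps

open MvPolynomial

variable {σ : Type*} {k : Type*} [Field k]

/-- An algebra map `φ : R → R[t]` with `φ ≡ id` modulo `t`. -/
def IsExpMap {R : Type*} [CommRing R] [Algebra k R] (φ : R →ₐ[k] Polynomial R) : Prop :=
  ∀ p, (φ p).coeff 0 = p

namespace IsExpMap

section

variable {R : Type*} [CommRing R] [Algebra k R] {φ : R →ₐ[k] Polynomial R}

theorem eq_C_of_natDegree_eq_zero (h : IsExpMap φ) {p : R} (hp : (φ p).natDegree = 0) :
    φ p = Polynomial.C p := by
  rw [Polynomial.eq_C_of_natDegree_eq_zero hp, h]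

/-- Invariants are factorially closed: the degree in t is additive over a domain, so the factors of
an invariant have degree 0 in t. -/
theorem eq_C_of_dvd [IsDomain R] (h : IsExpMap φ) {p q : R} (hq : q ≠ 0)
    (hφ : φ q = Polynomial.C q) (hpq : p ∣ q) : φ p = Polynomial.C p := by
  obtain ⟨r, rfl⟩ := hpq
  have hne : ∀ p, p ≠ 0 → φ p ≠ 0 := by
    intro p hp h0
    apply hp
    rw [← h p, h0, Polynomial.coeff_zero]
  apply h.eq_C_of_natDegree_eq_zero
  have := congrArg Polynomial.natDegree hφ
  rw [map_mul, Polynomial.natDegree_mul (hne _ (left_ne_zero_of_mul hq))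
    (hne _ (right_ne_zero_of_mul hq)), Polynomial.natDegree_C] at this
  omega

/-- The conjugate of `φ` by an automorphism. -/
noncomputable def _root_.AlgHom.conjExp (φ : R →ₐ[k] Polynomial R) (ε : R ≃ₐ[k] R) :
    R →ₐ[k] Polynomial R :=
  ((Polynomial.mapAlgHom (ε : R →ₐ[k] R)).comp φ).comp (ε.symm : R →ₐ[k] R)

theorem _root_.AlgHom.conjExp_apply (φ : R →ₐ[k] Polynomial R) (ε : R ≃ₐ[k] R) (p : R) :
    φ.conjExp ε (ε p) = (φ p).map (ε : R →+* R) := by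
  simp [AlgHom.conjExp, Polynomial.mapAlgHom]

theorem conjExp (h : IsExpMap φ) (ε : R ≃ₐ[k] R) : IsExpMap (φ.conjExp ε) := by
  intro p
  obtain ⟨p, rfl⟩ := ε.surjective p
  rw [AlgHom.conjExp_apply, Polynomial.coeff_map, h]
  rfl

theorem _root_.AlgHom.conjExp_eq_C_iff (φ : R →ₐ[k] Polynomial R) (ε : R ≃ₐ[k] R) (p : R) :
    φ.conjExp ε (ε p) = Polynomial.C (ε p) ↔ φ p = Polynomial.C p := by
  rw [AlgHom.conjExp_apply]
  have : Polynomial.C (ε p) = (Polynomial.C p).map (ε : R →+* R) := by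
    rw [Polynomial.map_C]; rfl
  rw [this]
  exact (Polynomial.map_injective _ ε.injective).eq_iff

end

variable {φ : MvPolynomial σ k →ₐ[k] Polynomial (MvPolynomial σ k)}

theorem of_X (h : ∀ i, (φ (X i)).coeff 0 = X i) : IsExpMap φ := by
  have : ((Polynomial.aeval (R := MvPolynomial σ k) (0 : MvPolynomial σ k)).restrictScalars k).comp
      φ = AlgHom.id k _ := by
    ext i : 1
    simpa [Polynomial.coeff_zero_eq_aeval_zero] using h i
  intro p
  simpa [Polynomial.coeff_zero_eq_aeval_zero] using DFunLike.congr_fun this p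

theorem eq_C_of_X (h : ∀ i, φ (X i) = Polynomial.C (X i)) (p : MvPolynomial σ k) :
    φ p = Polynomial.C p := by
  have : φ = (Algebra.ofId (MvPolynomial σ k) (Polynomial (MvPolynomial σ k))).restrictScalars k := by
    ext i : 1
    exact h i
  rw [this]
  rfl

/-- If all variables but one are invariant, then a nontrivial exponential map has no invariants
involving the remaining variable. -/
theorem trivial_or_aeval_update_eq [DecidableEq σ] (h : IsExpMap φ) {i : σ}
    (hX : ∀ j ≠ i, φ (X j) = Polynomial.C (X j)) {Q : MvPolynomial σ k}
    (hQ : φ Q = Polynomial.C Q) :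
    (∀ p, φ p = Polynomial.C p) ∨ aeval (Function.update X i 0) Q = Q := by
  -- `Q` read as a polynomial in `X i` whose coefficients involve only the other, invariant,
  -- variables; applying `φ` means substituting `φ (X i)`.
  set P : Polynomial (MvPolynomial σ k) :=
    aeval (Function.update (fun j => Polynomial.C (X j)) i Polynomial.X) Q with hP
  have hcomp : ∀ r : Polynomial (MvPolynomial σ k),
      P.comp r = aeval (Function.update (fun j => Polynomial.C (X j)) i r) Q := by
    intro r
    have : ((Polynomial.aeval (R := MvPolynomial σ k) r).restrictScalars k).comp
        (aeval (Function.update (fun j => Polynomial.C (X j)) i Polynomial.X)) =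
        aeval (Function.update (fun j => Polynomial.C (X j)) i r) := by
      ext j : 1
      rcases eq_or_ne j i with rfl | hj
      · simp
      · simp [hj]
    exact DFunLike.congr_fun this Q
  have hC : ∀ r : MvPolynomial σ k, P.comp (Polynomial.C r) =
      Polynomial.C (aeval (Function.update X i r) Q) := by
    intro r
    rw [hcomp]
    have : (aeval (Function.update (fun j => Polynomial.C (X j)) i (Polynomial.C r)) :
        MvPolynomial σ k →ₐ[k] Polynomial (MvPolynomial σ k)) =
        ((Algebra.ofId (MvPolynomial σ k) (Polynomial (MvPolynomial σ k))).restrictScalars k).comp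
          (aeval (Function.update X i r)) := by
      ext j : 1
      rcases eq_or_ne j i with rfl | hj
      · simp [Algebra.ofId_apply]
      · simp [hj, Algebra.ofId_apply]
    rw [this]
    rfl
  have h1 : P.comp (φ (X i)) = Polynomial.C Q := by
    rw [hcomp, ← hQ]
    have : aeval (Function.update (fun j => Polynomial.C (X j)) i (φ (X i))) = φ := by
      ext j : 1
      rcases eq_or_ne j i with rfl | hj
      · simp
      · simp [hj, hX j hj]
    rw [this]
  -- Degrees multiply under composition and the result is constant in t, so either `P` is constant
  -- or `φ (X i)` has degree 0 in t.
  have h2 := congrArg Polynomial.natDegree h1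
  rw [Polynomial.natDegree_comp, Polynomial.natDegree_C, mul_eq_zero] at h2
  rcases h2 with h2 | h2
  · right
    have h3 := hC 0
    have h4 := hC (X i)
    rw [Polynomial.eq_C_of_natDegree_eq_zero h2, Polynomial.C_comp] at h3 h4
    have h5 := Polynomial.C_injective (h3.symm.trans h4)
    rw [h5, Function.update_eq_self, aeval_X_left_apply]
  · left
    apply eq_C_of_X
    intro j
    rcases eq_or_ne j i with rfl | hj
    · exact h.eq_C_of_natDegree_eq_zero h2
    · exact hX j hj

end IsExpMap

/-- Coefficientwise partial derivative on `k[x][t]`. -/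
noncomputable def MvPolynomial.coeffPderiv (i : σ) :
    Derivation k (Polynomial (MvPolynomial σ k)) (Polynomial (MvPolynomial σ k)) :=
  PolynomialModule.equivPolynomialSelf.compDer ((pderiv (R := k) i).mapCoeffs)

theorem MvPolynomial.coeff_coeffPderiv (i : σ) (p : Polynomial (MvPolynomial σ k)) (n : ℕ) :
    (coeffPderiv i p).coeff n = pderiv i (p.coeff n) := rfl

theorem MvPolynomial.natDegree_coeffPderiv_le (i : σ) (p : Polynomial (MvPolynomial σ k)) :
    (coeffPderiv i p).natDegree ≤ p.natDegree := by
  rw [Polynomial.natDegree_le_iff_coeff_eq_zero]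
  intro n hn
  rw [coeff_coeffPderiv, Polynomial.coeff_eq_zero_of_natDegree_lt hn, map_zero]

theorem MvPolynomial.coeffPderiv_C (i : σ) (p : MvPolynomial σ k) :
    coeffPderiv i (Polynomial.C p) = Polynomial.C (pderiv i p) := by
  ext1 n
  rw [coeff_coeffPderiv, Polynomial.coeff_C, Polynomial.coeff_C]
  split_ifs <;> simp

/-- The binomial `z y^β - x^α` with coprime `α, β ≥ 2` is not invariant under nontrivial exponential
maps. -/
theorem IsExpMap.trivial_of_binomial
    {φ : MvPolynomial (Fin 2) k →ₐ[k] Polynomial (MvPolynomial (Fin 2) k)} (h : IsExpMap φ)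
    {α β : ℕ} (hα : 2 ≤ α) (hβ : 2 ≤ β) (hc : Nat.Coprime α β) {z : k} (hz : z ≠ 0)
    (hp : φ (C z * X 1 ^ β - X 0 ^ α) = Polynomial.C (C z * X 1 ^ β - X 0 ^ α)) :
    ∀ p, φ p = Polynomial.C p := by
  set x := φ (X 0) with hx
  set y := φ (X 1) with hy
  set Z : Polynomial (MvPolynomial (Fin 2) k) := Polynomial.C (C z) with hZ
  have hφZ : φ (C z) = Z := by
    rw [← MvPolynomial.algebraMap_eq, AlgHom.commutes]; rfl
  rw [map_sub, map_mul, map_pow, map_pow, hφZ, ← hx, ← hy] at hp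
  have hZ0 : Z ≠ 0 := by simpa [hZ] using hz
  -- degrees in `t`
  have hdeg : β * y.natDegree = α * x.natDegree := by
    have h1 : (Z * y ^ β).natDegree = β * y.natDegree := by
      rw [hZ, Polynomial.natDegree_C_mul (by simpa using hz), Polynomial.natDegree_pow]
    have h2 : (x ^ α).natDegree = α * x.natDegree := Polynomial.natDegree_pow _ _
    rw [← h1, ← h2]
    by_contra hne
    have h3 := congrArg Polynomial.natDegree hp
    rw [Polynomial.natDegree_C] at h3
    rcases lt_or_gt_of_ne hne with hlt | hlt
    · rw [Polynomial.natDegree_sub_eq_right_of_natDegree_lt hlt] at h3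
      omega
    · rw [Polynomial.natDegree_sub_eq_left_of_natDegree_lt hlt] at h3
      omega
  have hD : ∀ i : Fin 2, Z * ((β : Polynomial (MvPolynomial (Fin 2) k)) * y ^ (β - 1) *
      coeffPderiv i y) - (α : Polynomial (MvPolynomial (Fin 2) k)) * x ^ (α - 1) * coeffPderiv i x =
      Polynomial.C (pderiv i (C z * X 1 ^ β - X 0 ^ α)) := by
    intro i
    have h1 := congrArg (coeffPderiv (k := k) i) hp
    rw [coeffPderiv_C] at h1
    rw [← h1, map_sub, Derivation.leibniz, hZ, coeffPderiv_C, Derivation.leibniz_pow,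
      Derivation.leibniz_pow]
    simp [smul_eq_mul, mul_assoc]
  -- The Jacobian of (x, y) in the original variables; at t = 0 the pair is (`X 0`, `X 1`), where it
  -- equals 1.
  set J := coeffPderiv 0 x * coeffPderiv 1 y - coeffPderiv 1 x * coeffPderiv 0 y with hJ
  have hJ0 : J ≠ 0 := by
    intro h0
    have := congrArg (fun p => p.coeff 0) h0
    simp only [hJ, Polynomial.coeff_sub, Polynomial.mul_coeff_zero, coeff_coeffPderiv,
      Polynomial.coeff_zero] at this
    rw [hx, hy, h, h] at this
    simp [pderiv_X] at this
  set A := pderiv 0 (C z * X 1 ^ β - X 0 ^ α : MvPolynomial (Fin 2) k)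
  set B := pderiv 1 (C z * X 1 ^ β - X 0 ^ α : MvPolynomial (Fin 2) k)
  have hdegle : ∀ w : Polynomial (MvPolynomial (Fin 2) k),
      (Polynomial.C A * coeffPderiv 1 w - Polynomial.C B * coeffPderiv 0 w).natDegree ≤
        w.natDegree := fun w =>
    (Polynomial.natDegree_sub_le _ _).trans (max_le
      ((Polynomial.natDegree_C_mul_le _ _).trans (natDegree_coeffPderiv_le _ _))
      ((Polynomial.natDegree_C_mul_le _ _).trans (natDegree_coeffPderiv_le _ _)))
  -- Cramer's rule on the two identities `hD`: -α x^(α-1) J = A ∂₁y - B ∂₀y, and the right side has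
  -- degree in t at most that of y.
  have hx1 : (α : k) ≠ 0 → (α - 1) * x.natDegree ≤ y.natDegree := by
    intro hα0
    have h1 : -((α : Polynomial (MvPolynomial (Fin 2) k)) * (x ^ (α - 1) * J)) =
        Polynomial.C A * coeffPderiv 1 y - Polynomial.C B * coeffPderiv 0 y := by
      rw [← hD 0, ← hD 1, hJ]; ring
    have h2 := hdegle y
    rw [← h1, Polynomial.natDegree_neg] at h2
    have h3 : (α : Polynomial (MvPolynomial (Fin 2) k)) = Polynomial.C (C (α : k)) := by simp
    rw [h3, Polynomial.natDegree_C_mul ((map_ne_zero_iff _ (C_injective _ _)).2 hα0)] at h2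
    by_cases hx0 : x = 0
    · simp [hx0]
    rw [Polynomial.natDegree_mul (pow_ne_zero _ hx0) hJ0, Polynomial.natDegree_pow] at h2
    omega
  have hy1 : (β : k) ≠ 0 → (β - 1) * y.natDegree ≤ x.natDegree := by
    intro hβ0
    have h1 : -(Z * ((β : Polynomial (MvPolynomial (Fin 2) k)) * (y ^ (β - 1) * J))) =
        Polynomial.C A * coeffPderiv 1 x - Polynomial.C B * coeffPderiv 0 x := by
      rw [← hD 0, ← hD 1, hJ]; ring
    have h2 := hdegle x
    rw [← h1, Polynomial.natDegree_neg, hZ, Polynomial.natDegree_C_mul (by simpa using hz)] at h2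
    have h3 : (β : Polynomial (MvPolynomial (Fin 2) k)) = Polynomial.C (C (β : k)) := by simp
    rw [h3, Polynomial.natDegree_C_mul ((map_ne_zero_iff _ (C_injective _ _)).2 hβ0)] at h2
    by_cases hy0 : y = 0
    · simp [hy0]
    rw [Polynomial.natDegree_mul (pow_ne_zero _ hy0) hJ0, Polynomial.natDegree_pow] at h2
    omega
  -- By Bézout, coprime integers do not both vanish in `k`, so one of the two estimates is available
  -- in any characteristic.
  have hk : (α : k) ≠ 0 ∨ (β : k) ≠ 0 := by
    by_contra hcon
    push Not at hcon
    have hcast := congrArg (Int.cast : ℤ → k) (Nat.gcd_eq_gcd_ab α β)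
    rw [hc] at hcast
    simp [hcon.1, hcon.2] at hcast
  have hab : ¬ (α = 2 ∧ β = 2) := by
    rintro ⟨rfl, rfl⟩
    revert hc
    decide
  -- Together with `hdeg`, either estimate at a nonzero degree would give (α - 1)(β - 1) ≤ 1, that
  -- is α = β = 2.
  have h0 : x.natDegree = 0 ∧ y.natDegree = 0 := by
    obtain ⟨a, rfl⟩ := Nat.exists_eq_add_of_le hα
    obtain ⟨b, rfl⟩ := Nat.exists_eq_add_of_le hβ
    have hab' : 1 ≤ a + b := by omega
    rcases hk with hk | hk
    · have h1 := hx1 hk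
      rw [show 2 + a - 1 = a + 1 by omega] at h1
      have hx0 : x.natDegree = 0 := by
        by_contra hne
        have : 1 ≤ x.natDegree := by omega
        have h2 := Nat.mul_le_mul_left (2 + b) h1
        rw [hdeg] at h2
        have : a * x.natDegree + b * x.natDegree ≥ x.natDegree := by
          rw [← add_mul]; exact Nat.le_mul_of_pos_left _ hab'
        nlinarith [Nat.zero_le (a * b * x.natDegree)]
      refine ⟨hx0, ?_⟩
      rw [hx0, mul_zero] at hdeg
      rcases mul_eq_zero.1 hdeg with h | h
      · omega
      · exact h
    · have h1 := hy1 hk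
      rw [show 2 + b - 1 = b + 1 by omega] at h1
      have hy0 : y.natDegree = 0 := by
        by_contra hne
        have : 1 ≤ y.natDegree := by omega
        have h2 := Nat.mul_le_mul_left (2 + a) h1
        rw [← hdeg] at h2
        have : a * y.natDegree + b * y.natDegree ≥ y.natDegree := by
          rw [← add_mul]; exact Nat.le_mul_of_pos_left _ hab'
        nlinarith [Nat.zero_le (a * b * y.natDegree)]
      refine ⟨?_, hy0⟩
      rw [hy0, mul_zero] at hdeg
      rcases mul_eq_zero.1 hdeg.symm with h | h
      · omega
      · exact h
  apply IsExpMap.eq_C_of_X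
  intro i
  fin_cases i
  · exact h.eq_C_of_natDegree_eq_zero h0.1
  · exact h.eq_C_of_natDegree_eq_zero h0.2

end ExponentialMaps

/-! ### Top forms for rational weights -/

section TopForms

open MvPolynomial

open Finsupp (weight single weight_apply)

variable {σ : Type*} {k : Type*} [Field k]

/-- `Q` is weighted homogeneous of weight `d`, and `P - Q` has only terms of weight less than `d`. -/
def IsTopForm (w : σ → ℚ) (d : ℚ) (P Q : MvPolynomial σ k) : Prop :=
  (∀ m, coeff m Q ≠ 0 → weight w m = d) ∧ ∀ m, coeff m (P - Q) ≠ 0 → weight w m < d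

namespace IsTopForm

variable {w : σ → ℚ} {d d' : ℚ} {P Q P' Q' : MvPolynomial σ k}

theorem coeff_of_weight_eq (h : IsTopForm w d P Q) {m : σ →₀ ℕ} (hm : weight w m = d) :
    coeff m P = coeff m Q := by
  by_contra hne
  exact (h.2 m (by rwa [coeff_sub, sub_ne_zero])).ne hm

theorem weight_le (h : IsTopForm w d P Q) {m : σ →₀ ℕ} (hm : coeff m P ≠ 0) :
    weight w m ≤ d := by
  by_cases hQ : coeff m Q = 0
  · exact (h.2 m (by rwa [coeff_sub, hQ, sub_zero])).le
  · exact (h.1 m hQ).le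

theorem of_weight_le (h : ∀ m, coeff m P ≠ 0 → weight w m ≤ d) :
    IsTopForm w d P (weightedHomogeneousComponent w d P) := by
  classical
  refine ⟨fun m hm => ?_, fun m hm => ?_⟩
  · rw [coeff_weightedHomogeneousComponent] at hm
    by_contra hne
    exact hm (if_neg hne)
  · rw [coeff_sub, coeff_weightedHomogeneousComponent] at hm
    split_ifs at hm with hd
    · simp at hm
    · rw [sub_zero] at hm
      exact lt_of_le_of_ne (h m hm) hd

theorem unique (h : IsTopForm w d P Q) (h' : IsTopForm w d P Q') : Q = Q' := by
  ext m
  by_cases hm : weight w m = d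
  · rw [← h.coeff_of_weight_eq hm, h'.coeff_of_weight_eq hm]
  · have h1 : coeff m Q = 0 := by
      by_contra hne
      exact hm (h.1 m hne)
    have h2 : coeff m Q' = 0 := by
      by_contra hne
      exact hm (h'.1 m hne)
    rw [h1, h2]

protected theorem zero : IsTopForm w d (0 : MvPolynomial σ k) 0 := by
  constructor <;> simp

protected theorem add (h : IsTopForm w d P Q) (h' : IsTopForm w d P' Q') :
    IsTopForm w d (P + P') (Q + Q') := by
  refine ⟨fun m hm => ?_, fun m hm => ?_⟩
  · by_cases hQ : coeff m Q = 0
    · exact h'.1 m (by rwa [coeff_add, hQ, zero_add] at hm)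
    · exact h.1 m hQ
  · by_cases hQ : coeff m (P - Q) = 0
    · refine h'.2 m ?_
      rwa [add_sub_add_comm, coeff_add, hQ, zero_add] at hm
    · exact h.2 m hQ

protected theorem sum {ι : Type*} {s : Finset ι} {P Q : ι → MvPolynomial σ k}
    (h : ∀ i ∈ s, IsTopForm w d (P i) (Q i)) : IsTopForm w d (∑ i ∈ s, P i) (∑ i ∈ s, Q i) := by
  classical
  induction s using Finset.induction_on with
  | empty => simpa using IsTopForm.zero
  | insert a s ha ih =>
    rw [Finset.sum_insert ha, Finset.sum_insert ha]
    exact (h a (Finset.mem_insert_self _ _)).add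
      (ih fun i hi => h i (Finset.mem_insert_of_mem hi))

theorem to_zero (h : IsTopForm w d P Q) (hd : d < d') : IsTopForm w d' P 0 := by
  refine ⟨by simp, fun m hm => ?_⟩
  rw [sub_zero] at hm
  exact (h.weight_le hm).trans_lt hd

theorem exists_of_coeff_mul_ne_zero {A B : MvPolynomial σ k} {m : σ →₀ ℕ}
    (h : coeff m (A * B) ≠ 0) : ∃ a b, a + b = m ∧ coeff a A ≠ 0 ∧ coeff b B ≠ 0 := by
  classical
  rw [coeff_mul] at h
  obtain ⟨⟨a, b⟩, hab, hne⟩ := Finset.exists_ne_zero_of_sum_ne_zero h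
  exact ⟨a, b, Finset.HasAntidiagonal.mem_antidiagonal.1 hab, left_ne_zero_of_mul hne, right_ne_zero_of_mul hne⟩

protected theorem mul (h : IsTopForm w d P Q) (h' : IsTopForm w d' P' Q') :
    IsTopForm w (d + d') (P * P') (Q * Q') := by
  refine ⟨fun m hm => ?_, fun m hm => ?_⟩
  · obtain ⟨a, b, rfl, ha, hb⟩ := exists_of_coeff_mul_ne_zero hm
    rw [map_add, h.1 a ha, h'.1 b hb]
  · rw [show P * P' - Q * Q' = (P - Q) * P' + Q * (P' - Q') by ring, coeff_add] at hm
    by_cases h0 : coeff m ((P - Q) * P') = 0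
    · rw [h0, zero_add] at hm
      obtain ⟨a, b, rfl, ha, hb⟩ := exists_of_coeff_mul_ne_zero hm
      rw [map_add, h.1 a ha]
      exact add_lt_add_right (h'.2 b hb) _
    · obtain ⟨a, b, rfl, ha, hb⟩ := exists_of_coeff_mul_ne_zero h0
      rw [map_add]
      exact add_lt_add_of_lt_of_le (h.2 a ha) (h'.weight_le hb)

protected theorem C (c : k) : IsTopForm w 0 (C c : MvPolynomial σ k) (C c) := by
  classical
  refine ⟨fun m hm => ?_, by simp⟩
  rw [coeff_C] at hm
  by_cases h : 0 = m
  · rw [← h, map_zero]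
  · simp [h] at hm

end IsTopForm

/-- The analogue of `IsTopForm` for `k[x][t]`, where `t` has weight `τ`. -/
def IsTopFormPoly (w : σ → ℚ) (τ d : ℚ) (P Q : Polynomial (MvPolynomial σ k)) : Prop :=
  ∀ i : ℕ, IsTopForm w (d - i * τ) (P.coeff i) (Q.coeff i)

namespace IsTopFormPoly

variable {w : σ → ℚ} {τ d d' : ℚ} {P Q P' Q' : Polynomial (MvPolynomial σ k)}

theorem unique (h : IsTopFormPoly w τ d P Q) (h' : IsTopFormPoly w τ d P Q') : Q = Q' :=
  Polynomial.ext fun i => (h i).unique (h' i)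

protected theorem add (h : IsTopFormPoly w τ d P Q) (h' : IsTopFormPoly w τ d P' Q') :
    IsTopFormPoly w τ d (P + P') (Q + Q') := fun i => by
  rw [Polynomial.coeff_add, Polynomial.coeff_add]
  exact (h i).add (h' i)

protected theorem sum {ι : Type*} {s : Finset ι} {P Q : ι → Polynomial (MvPolynomial σ k)}
    (h : ∀ i ∈ s, IsTopFormPoly w τ d (P i) (Q i)) :
    IsTopFormPoly w τ d (∑ i ∈ s, P i) (∑ i ∈ s, Q i) := fun i => by
  rw [Polynomial.finsetSum_coeff, Polynomial.finsetSum_coeff]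
  exact IsTopForm.sum fun j hj => h j hj i

theorem to_zero (h : IsTopFormPoly w τ d P Q) (hd : d < d') : IsTopFormPoly w τ d' P 0 :=
  fun i => by
    rw [Polynomial.coeff_zero]
    exact (h i).to_zero (sub_lt_sub_right hd _)

protected theorem C {P Q : MvPolynomial σ k} (h : IsTopForm w d P Q) :
    IsTopFormPoly w τ d (Polynomial.C P) (Polynomial.C Q) := fun i => by
  rw [Polynomial.coeff_C, Polynomial.coeff_C]
  split_ifs with hi
  · subst hi
    simpa using h
  · exact IsTopForm.zero

protected theorem mul (h : IsTopFormPoly w τ d P Q) (h' : IsTopFormPoly w τ d' P' Q') :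
    IsTopFormPoly w τ (d + d') (P * P') (Q * Q') := fun n => by
  rw [Polynomial.coeff_mul, Polynomial.coeff_mul]
  refine IsTopForm.sum fun ij hij => ?_
  have : (d + d' - n * τ) = (d - ij.1 * τ) + (d' - ij.2 * τ) := by
    rw [← Finset.HasAntidiagonal.mem_antidiagonal.1 hij]
    push_cast
    ring
  rw [this]
  exact (h _).mul (h' _)

protected theorem pow (h : IsTopFormPoly w τ d P Q) (n : ℕ) :
    IsTopFormPoly w τ (n • d) (P ^ n) (Q ^ n) := by
  induction n with
  | zero => simpa using IsTopFormPoly.C (IsTopForm.C (w := w) (1 : k))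
  | succ n ih =>
    rw [pow_succ, pow_succ, succ_nsmul]
    exact ih.mul h

protected theorem prod {ι : Type*} {s : Finset ι} {d : ι → ℚ}
    {P Q : ι → Polynomial (MvPolynomial σ k)}
    (h : ∀ i ∈ s, IsTopFormPoly w τ (d i) (P i) (Q i)) :
    IsTopFormPoly w τ (∑ i ∈ s, d i) (∏ i ∈ s, P i) (∏ i ∈ s, Q i) := by
  classical
  induction s using Finset.induction_on with
  | empty => simpa using IsTopFormPoly.C (IsTopForm.C (w := w) (1 : k))
  | insert a s ha ih =>
    rw [Finset.sum_insert ha, Finset.prod_insert ha, Finset.prod_insert ha]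
    exact (h a (Finset.mem_insert_self _ _)).mul
      (ih fun i hi => h i (Finset.mem_insert_of_mem hi))

theorem map_monomial {φ ψ : MvPolynomial σ k →ₐ[k] Polynomial (MvPolynomial σ k)}
    (h : ∀ i, IsTopFormPoly w τ (w i) (φ (X i)) (ψ (X i))) (m : σ →₀ ℕ) (c : k) :
    IsTopFormPoly w τ (weight w m) (φ (monomial m c)) (ψ (monomial m c)) := by
  have hC : ∀ χ : MvPolynomial σ k →ₐ[k] Polynomial (MvPolynomial σ k),
      χ (MvPolynomial.C c) = Polynomial.C (MvPolynomial.C c) := by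
    intro χ
    rw [← MvPolynomial.algebraMap_eq, AlgHom.commutes]
    rfl
  rw [monomial_eq, map_mul, map_mul, hC, hC, Finsupp.prod, map_prod, map_prod, ← zero_add (weight w m)]
  simp only [map_pow]
  refine (IsTopFormPoly.C (IsTopForm.C c)).mul ?_
  rw [weight_apply, Finsupp.sum]
  exact IsTopFormPoly.prod fun i _ => (h i).pow _

/-- The terms of `Q` produce the top part, while those of `P - Q` stay below weight `d`. -/
theorem map {φ ψ : MvPolynomial σ k →ₐ[k] Polynomial (MvPolynomial σ k)}
    (h : ∀ i, IsTopFormPoly w τ (w i) (φ (X i)) (ψ (X i))) {d : ℚ} {P Q : MvPolynomial σ k}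
    (hPQ : IsTopForm w d P Q) : IsTopFormPoly w τ d (φ P) (ψ Q) := by
  have h1 : IsTopFormPoly w τ d (φ Q) (ψ Q) := by
    rw [Q.as_sum, map_sum, map_sum]
    refine IsTopFormPoly.sum fun m hm => ?_
    have := map_monomial h m (coeff m Q)
    rwa [hPQ.1 m (mem_support_iff.1 hm)] at this
  have h2 : IsTopFormPoly w τ d (φ (P - Q)) 0 := by
    rw [(P - Q).as_sum, map_sum, ← Finset.sum_const_zero (s := (P - Q).support)]
    refine IsTopFormPoly.sum fun m hm => ?_
    exact (map_monomial h m (coeff m (P - Q))).to_zero (hPQ.2 m (mem_support_iff.1 hm))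
  have h3 := h1.add h2
  rwa [← map_add, add_sub_cancel, add_zero] at h3

end IsTopFormPoly

/-- The hypothesis, with the same polynomial on both sides, says that every `ε (X i)` is weighted
homogeneous of weight `w i`. -/
theorem IsTopForm.map {w : σ → ℚ} {ε : MvPolynomial σ k →ₐ[k] MvPolynomial σ k}
    (h : ∀ i, IsTopForm w (w i) (ε (X i)) (ε (X i))) {d : ℚ} {P Q : MvPolynomial σ k}
    (hPQ : IsTopForm w d P Q) : IsTopForm w d (ε P) (ε Q) := by
  set φ := ((Algebra.ofId (MvPolynomial σ k)
    (Polynomial (MvPolynomial σ k))).restrictScalars k).comp ε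
  have := IsTopFormPoly.map (τ := 0) (φ := φ) (ψ := φ) (fun i => IsTopFormPoly.C (h i)) hPQ 0
  simpa [φ, Algebra.ofId_apply] using this

/-- A nontrivial exponential map can be replaced by one that fixes the top forms of the invariants of
the given one. -/
theorem IsExpMap.exists_top [Finite σ] {φ : MvPolynomial σ k →ₐ[k] Polynomial (MvPolynomial σ k)}
    (hφ : IsExpMap φ) (hnt : ¬ ∀ p, φ p = Polynomial.C p) (w : σ → ℚ) :
    ∃ ψ : MvPolynomial σ k →ₐ[k] Polynomial (MvPolynomial σ k), IsExpMap ψ ∧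
      (¬ ∀ p, ψ p = Polynomial.C p) ∧
      ∀ d P Q, IsTopForm w d P Q → φ P = Polynomial.C P → ψ Q = Polynomial.C Q := by
  classical
  have := Fintype.ofFinite σ
  set N := Finset.univ.sup fun j => (φ (X j)).natDegree with hN
  set E : Finset ((_ : σ) × (_ : ℕ) × (σ →₀ ℕ)) := Finset.univ.sigma fun j =>
    (Finset.Icc 1 N).sigma fun i => ((φ (X j)).coeff i).support with hE
  have hmem : ∀ j i m, 1 ≤ i → coeff m ((φ (X j)).coeff i) ≠ 0 → ⟨j, i, m⟩ ∈ E := by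
    intro j i m hi hm
    simp only [hE, Finset.mem_sigma, Finset.mem_univ, true_and, Finset.mem_Icc, mem_support_iff]
    refine ⟨⟨hi, le_trans ?_ (Finset.le_sup (f := fun j => (φ (X j)).natDegree)
      (Finset.mem_univ j))⟩, hm⟩
    apply Polynomial.le_natDegree_of_ne_zero
    rintro h0
    rw [h0, coeff_zero] at hm
    exact hm rfl
  have hEne : E.Nonempty := by
    by_contra hcon
    refine hnt (IsExpMap.eq_C_of_X fun j => hφ.eq_C_of_natDegree_eq_zero ?_)
    rw [← Nat.le_zero, Polynomial.natDegree_le_iff_coeff_eq_zero]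
    intro i hi
    ext m
    by_contra hm
    exact hcon ⟨_, hmem j i m hi (by simpa using hm)⟩
  -- The minimum τ is the largest weight of t for which no term of `φ (X j)` exceeds weight `w j`; a
  -- term attaining it survives in the top part and keeps ψ nontrivial.
  obtain ⟨⟨j₀, i₀, m₀⟩, he₀, hmin⟩ := E.exists_min_image
    (fun e => (w e.1 - weight w e.2.2) / (e.2.1 : ℚ)) hEne
  set τ : ℚ := (w j₀ - weight w m₀) / (i₀ : ℚ) with hτ
  simp only [hE, Finset.mem_sigma, Finset.mem_univ, true_and, Finset.mem_Icc,
    mem_support_iff] at he₀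
  obtain ⟨⟨hi₀, -⟩, hm₀⟩ := he₀
  have hle : ∀ j i m, coeff m ((φ (X j)).coeff i) ≠ 0 → weight w m ≤ w j - i * τ := by
    intro j i m hm
    rcases Nat.eq_zero_or_pos i with rfl | hi
    · rw [hφ, coeff_X] at hm
      have : single j 1 = m := by
        by_contra hne
        simp [hne] at hm
      rw [← this]
      simp [weight_apply]
    · have h1 := hmin _ (hmem j i m hi hm)
      have hi' : (0 : ℚ) < i := by exact_mod_cast hi
      rw [le_div_iff₀ hi'] at h1
      simp only at h1
      linarith
  set T : σ → Polynomial (MvPolynomial σ k) := fun j => ∑ i ∈ Finset.range (N + 1),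
    Polynomial.monomial i (weightedHomogeneousComponent w (w j - i * τ) ((φ (X j)).coeff i)) with hT
  have hTc : ∀ j i, (T j).coeff i =
      weightedHomogeneousComponent w (w j - i * τ) ((φ (X j)).coeff i) := by
    intro j i
    simp only [hT, Polynomial.finsetSum_coeff, Polynomial.coeff_monomial]
    rw [Finset.sum_ite_eq' (Finset.range (N + 1)) i]
    split_ifs with hi
    · rfl
    · rw [Polynomial.coeff_eq_zero_of_natDegree_lt, map_zero]
      have hj : (φ (X j)).natDegree ≤ N :=
        Finset.le_sup (f := fun j => (φ (X j)).natDegree) (Finset.mem_univ j)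
      rw [Finset.mem_range] at hi
      omega
  have hψ : ∀ j, IsTopFormPoly w τ (w j) (φ (X j))
      ((aeval T : MvPolynomial σ k →ₐ[k] Polynomial (MvPolynomial σ k)) (X j)) := by
    intro j i
    rw [aeval_X, hTc]
    exact IsTopForm.of_weight_le (hle j i)
  refine ⟨aeval T, IsExpMap.of_X fun j => ?_, fun htriv => ?_, fun d P Q hPQ hP => ?_⟩
  · rw [aeval_X, hTc, hφ]
    ext m
    rw [coeff_weightedHomogeneousComponent]
    split_ifs with hm
    · rfl
    · rw [coeff_X, if_neg]
      rintro rfl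
      simp [weight_apply] at hm
  · have h1 := htriv (X j₀)
    have h2 := hTc j₀ i₀
    rw [aeval_X] at h1
    rw [h1, Polynomial.coeff_C, if_neg (by omega)] at h2
    have h3 := congrArg (coeff m₀) h2
    rw [coeff_weightedHomogeneousComponent, if_pos] at h3
    · exact hm₀ h3.symm
    · have : (i₀ : ℚ) ≠ 0 := by
        have : i₀ ≠ 0 := by omega
        exact_mod_cast this
      rw [hτ]
      field_simp
      ring
  · have h1 := IsTopFormPoly.map hψ hPQ
    rw [hP] at h1
    exact h1.unique (IsTopFormPoly.C hPQ)

end TopForms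

/-! ### Weighted homogeneous polynomials in two variables -/

section Bivariate

open MvPolynomial

open Finsupp (weight single)

variable {k : Type u} [Field k]

theorem Finsupp.weight_fin_two (w : Fin 2 → ℚ) (m : Fin 2 →₀ ℕ) :
    weight w m = m 0 * w 0 + m 1 * w 1 := by
  rw [Finsupp.weight_apply, Finsupp.sum_fintype _ _ (by simp), Fin.sum_univ_two, nsmul_eq_mul,
    nsmul_eq_mul]

theorem MvPolynomial.add_le_totalDegree {p : MvPolynomial (Fin 2) k} {m : Fin 2 →₀ ℕ}
    (hm : coeff m p ≠ 0) : m 0 + m 1 ≤ p.totalDegree := by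
  have := le_totalDegree (mem_support_iff.2 hm)
  rwa [Finsupp.sum_fintype _ _ (by simp), Fin.sum_univ_two] at this

theorem MvPolynomial.totalDegree_fin_two_lt {p : MvPolynomial (Fin 2) k} {b : ℕ} (hb : 0 < b)
    (h : ∀ m, coeff m p ≠ 0 → m 0 + m 1 < b) : p.totalDegree < b := by
  refine (Finset.sup_lt_iff hb).2 fun m hm => ?_
  rw [Finsupp.sum_fintype _ _ (by simp), Fin.sum_univ_two]
  exact h m (mem_support_iff.1 hm)

theorem Finsupp.eq_single_one_of_fin_two {m : Fin 2 →₀ ℕ} (h0 : m 0 = 0) :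
    m = single 1 (m 1) := by
  ext i
  fin_cases i <;> simp [h0]

theorem MvPolynomial.apply_eq_zero_of_coeff_aeval_update {σ : Type*} [DecidableEq σ] (i : σ)
    (P : MvPolynomial σ k) : ∀ m, coeff m (aeval (Function.update X i 0) P :
      MvPolynomial σ k) ≠ 0 → m i = 0 := by
  induction P using MvPolynomial.induction_on with
  | C a =>
    intro m hm
    rw [aeval_C, MvPolynomial.algebraMap_eq, coeff_C] at hm
    by_cases h : 0 = m
    · rw [← h]; rfl
    · simp [h] at hm
  | add p q hp hq =>
    intro m hm
    rw [map_add, coeff_add] at hm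
    by_cases h : coeff m (aeval (Function.update X i 0) p : MvPolynomial σ k) = 0
    · rw [h, zero_add] at hm
      exact hq m hm
    · exact hp m h
  | mul_X p j hp =>
    intro m hm
    rw [map_mul, aeval_X] at hm
    obtain ⟨a, b, rfl, ha, hb⟩ := IsTopForm.exists_of_coeff_mul_ne_zero hm
    rw [Finsupp.add_apply, hp a ha, zero_add]
    rcases eq_or_ne j i with rfl | hj
    · simp at hb
    · rw [Function.update_of_ne hj, coeff_X] at hb
      by_cases h : single j 1 = b
      · rw [← h]; simp [hj]
      · simp [h] at hb

/-- A weighted homogeneous polynomial with at least two terms, one of them a power of `y`, has a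
binomial factor. -/
theorem MvPolynomial.exists_binomial_dvd [IsAlgClosed k] {α β b : ℕ} (hα : 1 ≤ α)
    (hc : Nat.Coprime α β) {Q : MvPolynomial (Fin 2) k}
    (hQ : ∀ m, coeff m Q ≠ 0 → β * m 0 + α * m 1 = α * b)
    (hb : coeff (single 1 b) Q ≠ 0) {m' : Fin 2 →₀ ℕ} (hm' : coeff m' Q ≠ 0) (hm0 : m' 0 ≠ 0) :
    ∃ z : k, z ≠ 0 ∧ (C z * X 1 ^ β - X 0 ^ α) ∣ Q := by
  have hinj : ∀ m, coeff m Q ≠ 0 → ∀ n, coeff n Q ≠ 0 → m 0 = n 0 → m = n := by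
    intro m hm n hn h
    have h1 := hQ m hm
    rw [← hQ n hn, h] at h1
    have h2 : m 1 = n 1 := Nat.eq_of_mul_eq_mul_left hα (by omega)
    ext i
    fin_cases i
    · exact h
    · exact h2
  -- This is Q(x, 1); by `hinj` no two terms collide. Its value at 0 is the coefficient of y^b, so
  -- its roots are nonzero.
  set q : Polynomial k := ∑ m ∈ Q.support, Polynomial.monomial (m 0) (coeff m Q) with hq
  have hcoeff : ∀ m, coeff m Q ≠ 0 → q.coeff (m 0) = coeff m Q := by
    intro m hm
    rw [hq, Polynomial.finsetSum_coeff, Finset.sum_eq_single m]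
    · rw [Polynomial.coeff_monomial, if_pos rfl]
    · intro n hn hne
      rw [Polynomial.coeff_monomial, if_neg]
      exact fun h => hne (hinj n (mem_support_iff.1 hn) m hm h)
    · intro h
      rw [Polynomial.coeff_monomial, if_pos rfl]
      exact notMem_support_iff.1 h
  have hdeg : q.degree ≠ 0 := by
    intro h
    have h1 : q.natDegree = 0 := Polynomial.natDegree_eq_of_degree_eq_some h
    have h2 : m' 0 ≤ q.natDegree :=
      Polynomial.le_natDegree_of_ne_zero (by rwa [hcoeff m' hm'])
    omega
  obtain ⟨z, hz⟩ := IsAlgClosed.exists_root q hdeg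
  have hz0 : z ≠ 0 := by
    rintro rfl
    have h1 := hcoeff _ hb
    rw [Polynomial.IsRoot.def, ← Polynomial.coeff_zero_eq_eval_zero] at hz
    rw [show (single (1 : Fin 2) b) 0 = 0 by simp, hz] at h1
    exact hb h1.symm
  refine ⟨z ^ α, pow_ne_zero _ hz0, ?_⟩
  -- The subtracted terms add up to q(z) y^b = 0, and every bracket is divisible by the binomial
  -- since α divides `m 0`.
  have hQeq : Q = ∑ m ∈ Q.support, C (coeff m Q) * (X 0 ^ m 0 * X 1 ^ m 1 - C z ^ m 0 * X 1 ^ b) := by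
    have h1 : ∑ m ∈ Q.support, C (coeff m Q) * (C z ^ m 0 * X 1 ^ b) =
        (0 : MvPolynomial (Fin 2) k) := by
      have h2 : ∑ m ∈ Q.support, coeff m Q * z ^ m 0 = 0 := by
        rw [Polynomial.IsRoot.def, hq, Polynomial.eval_finsetSum] at hz
        simpa using hz
      calc (∑ m ∈ Q.support, C (coeff m Q) * (C z ^ m 0 * X 1 ^ b) : MvPolynomial (Fin 2) k)
          = C (∑ m ∈ Q.support, coeff m Q * z ^ m 0) * X 1 ^ b := by
            rw [map_sum, Finset.sum_mul]
            exact Finset.sum_congr rfl fun m _ => by rw [map_mul, map_pow]; ring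
        _ = 0 := by rw [h2, map_zero, zero_mul]
    simp only [mul_sub, Finset.sum_sub_distrib]
    rw [h1, sub_zero]
    conv_lhs => rw [Q.as_sum]
    exact Finset.sum_congr rfl fun m _ => by rw [monomial_fin_two, mul_assoc]
  rw [hQeq]
  refine Finset.dvd_sum fun m hm => Dvd.dvd.mul_left ?_ _
  have h1 := hQ m (mem_support_iff.1 hm)
  have h2 : α ∣ m 0 := by
    refine hc.dvd_of_dvd_mul_left ?_
    have : α ∣ β * m 0 + α * m 1 := h1 ▸ Dvd.intro _ rfl
    exact (Nat.dvd_add_left (Dvd.intro _ rfl)).1 this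
  obtain ⟨i, hi⟩ := h2
  have h3 : b = β * i + m 1 := by
    refine Nat.eq_of_mul_eq_mul_left hα ?_
    rw [← h1, hi]
    ring
  have h4 : (X 0 ^ m 0 * X 1 ^ m 1 - C z ^ m 0 * X 1 ^ b : MvPolynomial (Fin 2) k) =
      -(((C (z ^ α) * X 1 ^ β) ^ i - (X 0 ^ α) ^ i) * X 1 ^ m 1) := by
    rw [hi, h3, map_pow]
    ring
  rw [h4, dvd_neg]
  exact Dvd.dvd.mul_right (sub_dvd_pow_sub_pow _ _ _) _

theorem isTopForm_X (w : Fin 2 → ℚ) (i : Fin 2) :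
    IsTopForm w (w i) (X i : MvPolynomial (Fin 2) k) (X i) := by
  refine ⟨fun m hm => ?_, by simp⟩
  rw [coeff_X] at hm
  by_cases h : single i 1 = m
  · rw [← h]
    simp [Finsupp.weight_apply]
  · simp [h] at hm

end Bivariate

/-! ### The Jung–van der Kulk theorem -/

namespace PolyAut

open MvPolynomial

open Finsupp (weight single)

variable {k : Type u} [Field k]

theorem bind₁_bind₁_comp {n : ℕ} {R : Type u} [CommRing R] (f g : PolyEnd n R)
    (p : MvPolynomial (Fin n) R) :
    bind₁ g.comp (bind₁ f.comp p) = bind₁ (f * g).comp p := by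
  rw [bind₁_bind₁]
  rfl

/-- The automorphism `p ↦ p ∘ f` of the polynomial ring. -/
noncomputable def algEquiv {n : ℕ} (f : PolyAut n k) :
    MvPolynomial (Fin n) k ≃ₐ[k] MvPolynomial (Fin n) k :=
  AlgEquiv.ofAlgHom (bind₁ f.val.comp) (bind₁ f.inv.comp)
    (by
      ext i : 1
      change bind₁ f.val.comp (bind₁ f.inv.comp (X i)) = X i
      rw [bind₁_bind₁_comp, f.inv_val, bind₁_X_right]
      rfl)
    (by
      ext i : 1
      change bind₁ f.inv.comp (bind₁ f.val.comp (X i)) = X i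
      rw [bind₁_bind₁_comp, f.val_inv, bind₁_X_right]
      rfl)

theorem algEquiv_apply {n : ℕ} (f : PolyAut n k) (p : MvPolynomial (Fin n) k) :
    f.algEquiv p = bind₁ f.val.comp p := rfl

theorem algEquiv_X {n : ℕ} (f : PolyAut n k) (i : Fin n) : f.algEquiv (X i) = f.val.comp i := by
  rw [algEquiv_apply, bind₁_X_right]

theorem mul_val_comp {n : ℕ} (f g : PolyAut n k) (i : Fin n) :
    (f * g).val.comp i = g.algEquiv (f.val.comp i) := rfl

/-- The second component of an automorphism is invariant under a nontrivial exponential map. -/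
theorem exists_expMap (f : PolyAut 2 k) :
    ∃ φ : MvPolynomial (Fin 2) k →ₐ[k] Polynomial (MvPolynomial (Fin 2) k), IsExpMap φ ∧
      (¬ ∀ p, φ p = Polynomial.C p) ∧ φ (f.val.comp 1) = Polynomial.C (f.val.comp 1) := by
  -- The translation x ↦ x + t fixes y, so its conjugate by `f` fixes the second component of `f`.
  set θ : MvPolynomial (Fin 2) k →ₐ[k] Polynomial (MvPolynomial (Fin 2) k) :=
    aeval ![Polynomial.C (X 0) + Polynomial.X, Polynomial.C (X 1)] with hθ
  have hexp : IsExpMap θ := IsExpMap.of_X fun i => by fin_cases i <;> simp [hθ]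
  refine ⟨θ.conjExp f.algEquiv, hexp.conjExp _, fun h => ?_, ?_⟩
  · have h1 := (AlgHom.conjExp_eq_C_iff θ f.algEquiv (X 0)).1 (h _)
    simp [hθ] at h1
  · rw [← algEquiv_X, AlgHom.conjExp_eq_C_iff]
    simp [hθ]

/-- The automorphism exchanging the coordinates. -/
noncomputable def swap (k : Type u) [Field k] : PolyAut 2 k where
  val := ⟨![X 1, X 0]⟩
  inv := ⟨![X 1, X 0]⟩
  val_inv := by
    ext1
    funext i
    fin_cases i <;> simp [PolyEnd.mul_comp, PolyEnd.one_comp]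
  inv_val := by
    ext1
    funext i
    fin_cases i <;> simp [PolyEnd.mul_comp, PolyEnd.one_comp]

theorem swap_comp_zero : (swap k).val.comp 0 = X 1 := rfl

theorem swap_comp_one : (swap k).val.comp 1 = X 0 := rfl

theorem swap_mem : swap k ∈ ⨆ i, amalgamFactor k i := by
  refine Subgroup.mem_iSup_of_mem false ?_
  have : degree (swap k) ≤ 1 := by
    rw [degree_eq_max, swap_comp_zero, swap_comp_one, totalDegree_X, totalDegree_X, max_self]
  exact ⟨this, this⟩

theorem triangular_mem (a b : kˣ) (P : Polynomial k) (c : k) :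
    triangular a b P c ∈ ⨆ i, amalgamFactor k i :=
  Subgroup.mem_iSup_of_mem true ⟨a, b, P, c, rfl⟩

theorem triangular_comp_zero (a b : kˣ) (P : Polynomial k) (c : k) :
    (triangular a b P c).val.comp 0 = C (a : k) * X 0 + Polynomial.aeval (X 1) P := rfl

theorem triangular_comp_one (a b : kˣ) (P : Polynomial k) (c : k) :
    (triangular a b P c).val.comp 1 = C (b : k) * X 1 + C c := rfl

/-- An automorphism turning the binomial `z y^β - x` into `x`. -/
noncomputable def straighten (z : k) (β : ℕ) : PolyAut 2 k :=
  triangular (-1) 1 (Polynomial.C z * Polynomial.X ^ β) 0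

theorem straighten_comp_zero (z : k) (β : ℕ) :
    (straighten z β).val.comp 0 = C z * X 1 ^ β - X 0 := by
  rw [straighten, triangular_comp_zero]
  simp [MvPolynomial.algebraMap_eq]
  ring

theorem straighten_comp_one (z : k) (β : ℕ) : (straighten z β).val.comp 1 = X 1 := by
  rw [straighten, triangular_comp_one]
  simp

theorem straighten_binomial (z : k) (β : ℕ) :
    (straighten z β).algEquiv (C z * X 1 ^ β - X 0) = X 0 := by
  rw [map_sub, map_mul, map_pow, algEquiv_X, algEquiv_X, straighten_comp_zero,
    straighten_comp_one, algEquiv_apply, bind₁_C_right]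
  ring

/-- When x weighs β times as much as y, the components z y^β - x and y are weighted homogeneous. -/
theorem isTopForm_algEquiv_straighten (z : k) {β : ℕ} {w : Fin 2 → ℚ} (hw : w 0 = β * w 1)
    {d : ℚ} {P Q : MvPolynomial (Fin 2) k} (h : IsTopForm w d P Q) :
    IsTopForm w d ((straighten z β).algEquiv P) ((straighten z β).algEquiv Q) := by
  refine IsTopForm.map (ε := ((straighten z β).algEquiv : _ →ₐ[k] _)) (fun i => ?_) h
  change IsTopForm w (w i) ((straighten z β).algEquiv (X i)) ((straighten z β).algEquiv (X i))
  fin_cases i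
  · change IsTopForm w (w 0) ((straighten z β).algEquiv (X 0)) ((straighten z β).algEquiv (X 0))
    rw [algEquiv_X, straighten_comp_zero, sub_eq_add_neg]
    have hpow : ∀ n : ℕ, IsTopForm w (n * w 1) (X 1 ^ n : MvPolynomial (Fin 2) k) (X 1 ^ n) := by
      intro n
      induction n with
      | zero => simpa using IsTopForm.C (w := w) (1 : k)
      | succ n ih =>
        have := ih.mul (isTopForm_X w 1)
        rwa [← pow_succ, show (n : ℚ) * w 1 + w 1 = ((n + 1 : ℕ) : ℚ) * w 1 by push_cast; ring]
          at this
    have h1 := (IsTopForm.C (w := w) z).mul (hpow β)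
    have h2 := (IsTopForm.C (w := w) (-1 : k)).mul (isTopForm_X (k := k) w 0)
    rw [zero_add, ← hw] at h1
    rw [zero_add, map_neg, map_one, neg_one_mul] at h2
    exact h1.add h2
  · change IsTopForm w (w 1) ((straighten z β).algEquiv (X 1)) ((straighten z β).algEquiv (X 1))
    rw [algEquiv_X, straighten_comp_one]
    exact isTopForm_X w 1

theorem isTopForm_algEquiv_swap {w : Fin 2 → ℚ} (hw : w 0 = w 1)
    {d : ℚ} {P Q : MvPolynomial (Fin 2) k} (h : IsTopForm w d P Q) :
    IsTopForm w d ((swap k).algEquiv P) ((swap k).algEquiv Q) := by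
  refine IsTopForm.map (ε := ((swap k).algEquiv : _ →ₐ[k] _)) (fun i => ?_) h
  change IsTopForm w (w i) ((swap k).algEquiv (X i)) ((swap k).algEquiv (X i))
  fin_cases i
  · change IsTopForm w (w 0) ((swap k).algEquiv (X 0)) ((swap k).algEquiv (X 0))
    rw [algEquiv_X, swap_comp_zero, hw]
    exact isTopForm_X w 1
  · change IsTopForm w (w 1) ((swap k).algEquiv (X 1)) ((swap k).algEquiv (X 1))
    rw [algEquiv_X, swap_comp_one, ← hw]
    exact isTopForm_X w 0

/-- If a nontrivial exponential map fixes `Q` and a divisor `p` of `Q` which is a variable in suitable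
coordinates, then `Q` is a polynomial in this variable. -/
theorem apply_eq_zero_of_dvd {ψ : MvPolynomial (Fin 2) k →ₐ[k] Polynomial (MvPolynomial (Fin 2) k)}
    (hψ : IsExpMap ψ) (hnt : ¬ ∀ p, ψ p = Polynomial.C p) {Q : MvPolynomial (Fin 2) k} (hQ0 : Q ≠ 0)
    (hQ : ψ Q = Polynomial.C Q) (e : PolyAut 2 k) {i j : Fin 2} (hij : ∀ l ≠ i, l = j)
    (hdvd : X j ∣ e.algEquiv Q) {m : Fin 2 →₀ ℕ} (hm : coeff m (e.algEquiv Q) ≠ 0) : m i = 0 := by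
  have h1 := hψ.conjExp e.algEquiv
  have h2 : ψ.conjExp e.algEquiv (e.algEquiv Q) = Polynomial.C (e.algEquiv Q) :=
    (AlgHom.conjExp_eq_C_iff ψ _ _).2 hQ
  have h3 : e.algEquiv Q ≠ 0 := by simpa using hQ0
  -- The divisor `X j` is invariant as well, so only `X i` can be moved.
  have h4 := h1.eq_C_of_dvd h3 h2 hdvd
  rcases h1.trivial_or_aeval_update_eq (i := i) (fun l hl => by rw [hij l hl]; exact h4) h2 with h | h
  · exact absurd (fun p => (AlgHom.conjExp_eq_C_iff ψ e.algEquiv p).1 (h _)) hnt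
  · rw [← h] at hm
    exact apply_eq_zero_of_coeff_aeval_update i _ m hm

/-- After a linear change of coordinates, the leading form of the second component of an automorphism
is a multiple of a power of `y`. -/
theorem exists_leading_form [IsAlgClosed k] (f : PolyAut 2 k)
    (hb : 1 ≤ (f.val.comp 1).totalDegree) :
    ∃ e ∈ ⨆ i, amalgamFactor k i, ∀ m, coeff m ((f * e).val.comp 1) ≠ 0 →
      m 0 + m 1 ≤ (f.val.comp 1).totalDegree ∧
        (m 0 + m 1 = (f.val.comp 1).totalDegree → m 0 = 0) := by
  set G := f.val.comp 1 with hG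
  set b := G.totalDegree with hbdef
  set w : Fin 2 → ℚ := fun _ => 1 with hw
  have hwt : ∀ m : Fin 2 →₀ ℕ, weight w m = ((m 0 + m 1 : ℕ) : ℚ) := by
    intro m
    rw [Finsupp.weight_fin_two, hw]
    push_cast
    ring
  have htop : IsTopForm w b G (weightedHomogeneousComponent w (b : ℚ) G) :=
    IsTopForm.of_weight_le fun m hm => by
      rw [hwt]
      exact_mod_cast add_le_totalDegree hm
  set Q := weightedHomogeneousComponent w (b : ℚ) G with hQdef
  obtain ⟨φ, hφ, hφnt, hφG⟩ := f.exists_expMap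
  obtain ⟨ψ, hψ, hψnt, hψtop⟩ := hφ.exists_top hφnt w
  have hψQ := hψtop _ _ _ htop hφG
  have hQm : ∀ m, coeff m Q ≠ 0 → m 0 + m 1 = b := by
    intro m hm
    have := htop.1 m hm
    rw [hwt] at this
    exact_mod_cast this
  have hQ0 : Q ≠ 0 := by
    intro h0
    have : G.totalDegree < b := totalDegree_fin_two_lt (by omega) fun m hm => by
      refine lt_of_le_of_ne (add_le_totalDegree hm) fun h => hm ?_
      rw [htop.coeff_of_weight_eq (m := m) (by rw [hwt, h]), h0, coeff_zero]
    omega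
  -- If y^b is missing from `Q`, then x divides `Q`; if it occurs with another monomial, some z y -
  -- x divides `Q`; otherwise y does. A suitable change of coordinates turns this factor into y.
  have key : ∃ e ∈ ⨆ i, amalgamFactor k i, IsTopForm w b (e.algEquiv G) (e.algEquiv Q) ∧
      X 1 ∣ e.algEquiv Q := by
    have hX : ∀ i : Fin 2, (∀ m, coeff m Q ≠ 0 → m i ≠ 0) → X i ∣ Q := by
      intro i h
      rw [Q.as_sum]
      refine Finset.dvd_sum fun m hm => ?_
      rw [X_dvd_monomial]
      exact Or.inr (h m (mem_support_iff.1 hm))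
    by_cases h0 : coeff (single 1 b) Q = 0
    · refine ⟨swap k, swap_mem, isTopForm_algEquiv_swap rfl htop, ?_⟩
      have h1 : X 0 ∣ Q := hX 0 fun m hm hm0 => hm (by
        have := hQm m hm
        rw [Finsupp.eq_single_one_of_fin_two hm0, show m 1 = b by omega, h0])
      have h2 := map_dvd (swap k).algEquiv h1
      rwa [algEquiv_X, swap_comp_zero] at h2
    by_cases h1 : ∃ m, coeff m Q ≠ 0 ∧ m 0 ≠ 0
    · obtain ⟨m', hm', hm0⟩ := h1
      obtain ⟨z, hz, hdvd⟩ := exists_binomial_dvd (α := 1) (β := 1) le_rfl (by decide)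
        (fun m hm => by rw [one_mul, one_mul, one_mul]; exact hQm m hm) h0 hm' hm0
      rw [pow_one (X 0)] at hdvd
      refine ⟨straighten z 1 * swap k, mul_mem (triangular_mem _ _ _ _) swap_mem, ?_, ?_⟩
      · have h2 := isTopForm_algEquiv_swap rfl
          (isTopForm_algEquiv_straighten z (β := 1) (by simp [hw]) htop)
        simpa only [algEquiv_apply, bind₁_bind₁_comp, Units.val_mul] using h2
      · have h2 := map_dvd (swap k).algEquiv (map_dvd (straighten z 1).algEquiv hdvd)
        rw [straighten_binomial, algEquiv_X, swap_comp_zero] at h2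
        simpa only [algEquiv_apply, bind₁_bind₁_comp, Units.val_mul] using h2
    · push Not at h1
      have h2 : (1 : PolyAut 2 k).algEquiv = AlgEquiv.refl := by
        ext p : 1
        exact aeval_X_left_apply p
      refine ⟨1, one_mem _, by simpa [h2] using htop, ?_⟩
      rw [h2]
      exact hX 1 fun m hm => by
        have := hQm m hm
        have := h1 m hm
        omega
  obtain ⟨e, he, htope, hdvd⟩ := key
  refine ⟨e, he, fun m hm => ?_⟩
  rw [mul_val_comp] at hm
  have h1 := htope.weight_le hm
  rw [hwt] at h1
  refine ⟨by exact_mod_cast h1, fun h => ?_⟩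
  rw [htope.coeff_of_weight_eq (by rw [hwt, h])] at hm
  exact apply_eq_zero_of_dvd hψ hψnt hQ0 hψQ e (i := 0) (j := 1) (by decide) hdvd hm

/-- Otherwise the second component is P(y), and composing with the inverse writes y as `P` of a
polynomial, which forces deg P = 1. -/
theorem exists_coeff_ne_zero (f : PolyAut 2 k) (hb : 2 ≤ (f.val.comp 1).totalDegree) :
    ∃ m, coeff m (f.val.comp 1) ≠ 0 ∧ m 0 ≠ 0 := by
  by_contra hcon
  push Not at hcon
  set G := f.val.comp 1 with hG
  set P : Polynomial k := aeval ![0, Polynomial.X] G with hP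
  have hGP : Polynomial.aeval (X 1) P = G := by
    have h1 : ((Polynomial.aeval (R := k) (X 1 : MvPolynomial (Fin 2) k)).comp
        (aeval ![0, Polynomial.X])) = aeval ![0, X 1] := by
      ext i : 1
      fin_cases i <;> simp
    have h2 : Polynomial.aeval (X 1) P = aeval ![0, (X 1 : MvPolynomial (Fin 2) k)] G :=
      DFunLike.congr_fun h1 G
    rw [h2]
    conv_lhs => rw [G.as_sum]
    conv_rhs => rw [G.as_sum]
    rw [map_sum]
    refine Finset.sum_congr rfl fun m hm => ?_
    rw [monomial_fin_two, hcon m (mem_support_iff.1 hm)]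
    simp [MvPolynomial.algebraMap_eq]
  have h1 : G.totalDegree = P.natDegree := by
    rw [← hGP, totalDegree_aeval_polynomial, totalDegree_X, mul_one]
  have h2 : bind₁ f.inv.comp G = X 1 := by
    have : (f.val * f.inv).comp 1 = X 1 := by rw [f.val_inv]; rfl
    exact this
  rw [← hGP, ← Polynomial.aeval_algHom_apply, bind₁_X_right] at h2
  have h3 := congrArg totalDegree h2
  rw [totalDegree_aeval_polynomial, totalDegree_X] at h3
  have := Nat.eq_one_of_mul_eq_one_right h3
  omega

/-- The degree of the second component of an automorphism can be lowered. -/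
theorem exists_totalDegree_lt [IsAlgClosed k] (f : PolyAut 2 k)
    (hb : 2 ≤ (f.val.comp 1).totalDegree)
    (hlead : ∀ m, coeff m (f.val.comp 1) ≠ 0 →
      m 0 + m 1 = (f.val.comp 1).totalDegree → m 0 = 0) :
    ∃ e ∈ ⨆ i, amalgamFactor k i,
      ((f * e).val.comp 1).totalDegree < (f.val.comp 1).totalDegree := by
  obtain ⟨m₁, hm₁, hm₁0⟩ := f.exists_coeff_ne_zero hb
  obtain ⟨φ, hφ, hφnt, hφG⟩ := f.exists_expMap
  set G := f.val.comp 1 with hG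
  set b := G.totalDegree with hbdef
  have hGb : coeff (single 1 b) G ≠ 0 := by
    intro h0
    have : G.totalDegree < b := totalDegree_fin_two_lt (by omega) fun m hm => by
      refine lt_of_le_of_ne (add_le_totalDegree hm) fun h => hm ?_
      have h1 := hlead m hm h
      rw [Finsupp.eq_single_one_of_fin_two h1, show m 1 = b by omega, h0]
    omega
  have hlt : ∀ m, coeff m G ≠ 0 → m 0 ≠ 0 → m 0 + m 1 < b := fun m hm hm0 =>
    lt_of_le_of_ne (add_le_totalDegree hm) fun h => hm0 (hlead m hm h)
  -- `m'` lies on the edge of the Newton polygon issuing from y^b; with β/α its minimal quotient in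
  -- lowest terms, the weights (β, α) put y^b and `m'` on top.
  obtain ⟨m', hm', hmin⟩ := (G.support.filter fun m => m 0 ≠ 0).exists_min_image
    (fun m => ((b : ℚ) - m 1) / m 0) ⟨m₁, by simp [hm₁, hm₁0]⟩
  rw [Finset.mem_filter, mem_support_iff] at hm'
  obtain ⟨hm', hm'0⟩ := hm'
  have hm'lt := hlt m' hm' hm'0
  obtain ⟨B, hB⟩ := Nat.exists_eq_add_of_le (show m' 1 ≤ b by omega)
  obtain ⟨α, β, hc, hα, hβ⟩ := Nat.exists_coprime (m' 0) B
  set g := Nat.gcd (m' 0) B with hg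
  have hg0 : 0 < g := Nat.gcd_pos_of_pos_left _ (by omega)
  have hα1 : 1 ≤ α := by
    rcases Nat.eq_zero_or_pos α with h | h
    · rw [h, zero_mul] at hα
      exact absurd hα hm'0
    · exact h
  have hαβ : α < β := by
    have : α * g < β * g := by omega
    exact Nat.lt_of_mul_lt_mul_right this
  have hgQ : (0 : ℚ) < g := by exact_mod_cast hg0
  have hwle : ∀ m, coeff m G ≠ 0 → β * m 0 + α * m 1 ≤ α * b := by
    intro m hm
    by_cases hm0 : m 0 = 0
    · rw [hm0, mul_zero, zero_add]
      have := add_le_totalDegree hm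
      exact Nat.mul_le_mul_left _ (by omega)
    · have h1 := hmin m (by simp [hm, hm0])
      have h2 : (0 : ℚ) < m 0 := by exact_mod_cast Nat.pos_of_ne_zero hm0
      have h3 : (0 : ℚ) < m' 0 := by exact_mod_cast Nat.pos_of_ne_zero hm'0
      rw [div_le_div_iff₀ h3 h2] at h1
      have h4 : (b : ℚ) - m' 1 = β * g := by
        rw [hB, hβ]; push_cast; ring
      have h5 : (m' 0 : ℚ) = α * g := by exact_mod_cast hα
      rw [h4, h5] at h1
      have h6 : ((β : ℚ) * m 0 + α * m 1) ≤ α * b := by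
        refine le_of_mul_le_mul_right ?_ hgQ
        linarith
      exact_mod_cast h6
  set w : Fin 2 → ℚ := ![(β : ℚ), (α : ℚ)] with hw
  have hwt : ∀ m : Fin 2 →₀ ℕ, weight w m = ((β * m 0 + α * m 1 : ℕ) : ℚ) := by
    intro m
    rw [Finsupp.weight_fin_two]
    simp [hw]
    ring
  have htop : IsTopForm w ((α * b : ℕ) : ℚ) G
      (weightedHomogeneousComponent w ((α * b : ℕ) : ℚ) G) :=
    IsTopForm.of_weight_le fun m hm => by
      rw [hwt]
      exact_mod_cast hwle m hm
  set Q := weightedHomogeneousComponent w ((α * b : ℕ) : ℚ) G with hQdef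
  obtain ⟨ψ, hψ, hψnt, hψtop⟩ := hφ.exists_top hφnt w
  have hψQ := hψtop _ _ _ htop hφG
  have hQm : ∀ m, coeff m Q ≠ 0 → β * m 0 + α * m 1 = α * b := by
    intro m hm
    have := htop.1 m hm
    rw [hwt] at this
    exact_mod_cast this
  have hQb : coeff (single 1 b) Q ≠ 0 := by
    rwa [← htop.coeff_of_weight_eq]
    rw [hwt]
    simp
  have hQm' : coeff m' Q ≠ 0 := by
    rwa [← htop.coeff_of_weight_eq]
    rw [hwt, hB, hα, hβ]
    congr 1
    ring
  have hQ0 : Q ≠ 0 := by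
    rintro h
    rw [h, coeff_zero] at hQb
    exact hQb rfl
  obtain ⟨z, hz, hdvd⟩ := exists_binomial_dvd hα1 hc hQm hQb hQm' hm'0
  -- Since β > α, the case α ≥ 2 would give an invariant binomial with both exponents at least 2.
  have hα' : α = 1 := by
    by_contra hne
    exact hψnt (hψ.trivial_of_binomial (by omega) (by omega) hc hz (hψ.eq_C_of_dvd hQ0 hψQ hdvd))
  subst hα'
  rw [pow_one (X 0)] at hdvd
  refine ⟨straighten z β, triangular_mem _ _ _ _, totalDegree_fin_two_lt (by omega) fun m hm => ?_⟩
  rw [mul_val_comp] at hm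
  have htope := isTopForm_algEquiv_straighten z (β := β) (by simp [hw]) htop
  have h1 := htope.weight_le hm
  rw [hwt, one_mul, one_mul] at h1
  have h1 : β * m 0 + m 1 ≤ b := by exact_mod_cast h1
  -- As β ≥ 2, terms involving x and of weight at most b have total degree below b. The only other
  -- candidate is y^b, absent because the straightened top form is a polynomial in x alone.
  rcases Nat.eq_zero_or_pos (m 0) with h0 | h0
  · rw [h0, mul_zero, zero_add] at h1
    rw [h0, zero_add]
    refine lt_of_le_of_ne h1 fun h => ?_
    rw [htope.coeff_of_weight_eq (by rw [hwt, h0, h, mul_zero, zero_add])] at hm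
    have h2 := map_dvd (straighten z β).algEquiv hdvd
    rw [straighten_binomial] at h2
    have h3 := apply_eq_zero_of_dvd hψ hψnt hQ0 hψQ _ (i := 1) (j := 0) (by decide) h2 hm
    omega
  · nlinarith

/-- An automorphism whose second component is `b y + c` is triangular. -/
theorem mem_triangularSubgroup_of_comp_one (f : PolyAut 2 k) {b c : k}
    (hf : f.val.comp 1 = C b * X 1 + C c) : f ∈ triangularSubgroup k := by
  -- k[x, y] is read as k[y][x], and `lam` translates back.
  set χ : MvPolynomial (Fin 2) k →ₐ[k] Polynomial (Polynomial k) :=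
    aeval ![Polynomial.X, Polynomial.C Polynomial.X] with hχ
  set lam : Polynomial (Polynomial k) →+* MvPolynomial (Fin 2) k :=
    Polynomial.eval₂RingHom (Polynomial.aeval (R := k) (X 1 : MvPolynomial (Fin 2) k)).toRingHom (X 0)
    with hlam
  have hlamχ : ∀ p, lam (χ p) = p := by
    intro p
    have : lam.comp χ.toRingHom = RingHom.id _ := by
      apply MvPolynomial.ringHom_ext
      · intro r
        simp [hχ, hlam, MvPolynomial.algebraMap_eq,
          Polynomial.algebraMap_apply]
      · intro i
        fin_cases i <;> simp [hχ, hlam]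
    exact DFunLike.congr_fun this p
  set F := f.val.comp 0 with hF
  set H' : Polynomial (Polynomial k) :=
    aeval ![Polynomial.X, Polynomial.C (Polynomial.C b * Polynomial.X + Polynomial.C c)]
      (f.inv.comp 0) with hH'
  -- The first component of f⁻¹ ∘ f, computed over k[y]. Hence `χ F` has degree 1 in x and its
  -- leading coefficient is a unit of k[y], a nonzero constant.
  have hcomp : H'.comp (χ F) = Polynomial.X := by
    have h1 : ((Polynomial.aeval (R := Polynomial k) (χ F)).restrictScalars k).comp
        (aeval ![Polynomial.X, Polynomial.C (Polynomial.C b * Polynomial.X + Polynomial.C c)]) =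
        χ.comp (bind₁ f.val.comp) := by
      ext i : 1
      fin_cases i
      · simp [hF]
      · simp [hf, hχ,
          Polynomial.algebraMap_apply]
    have h2 : (f.inv * f.val).comp 0 = X 0 := by rw [f.inv_val]; rfl
    have h3 : H'.comp (χ F) = χ ((f.inv * f.val).comp 0) := DFunLike.congr_fun h1 (f.inv.comp 0)
    rw [h3, h2]
    simp [hχ]
  have hdeg := congrArg Polynomial.natDegree hcomp
  rw [Polynomial.natDegree_comp, Polynomial.natDegree_X] at hdeg
  have hd1 := Nat.eq_one_of_mul_eq_one_right hdeg
  have hd2 := Nat.eq_one_of_mul_eq_one_left hdeg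
  have hunit : IsUnit ((χ F).coeff 1) := by
    have h1 := congrArg (fun p => Polynomial.coeff p 1) hcomp
    simp only [Polynomial.coeff_X_one] at h1
    rw [Polynomial.eq_X_add_C_of_natDegree_le_one hd1.le] at h1
    simp only [Polynomial.add_comp, Polynomial.mul_comp, Polynomial.C_comp, Polynomial.X_comp,
      Polynomial.coeff_add, Polynomial.coeff_C_mul, Polynomial.coeff_C_succ, add_zero] at h1
    exact isUnit_iff_exists_inv'.2 ⟨_, h1⟩
  obtain ⟨a, ha, haF⟩ := Polynomial.isUnit_iff.1 hunit
  obtain ⟨a, rfl⟩ := ha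
  have hFeq : F = C (a : k) * X 0 + Polynomial.aeval (X 1) ((χ F).coeff 0) := by
    conv_lhs => rw [← hlamχ F, Polynomial.eq_X_add_C_of_natDegree_le_one hd2.le, ← haF]
    simp [hlam, MvPolynomial.algebraMap_eq]
  have hb : b ≠ 0 := by
    rintro rfl
    have h1 : (f.val * f.inv).comp 1 = X 1 := by rw [f.val_inv]; rfl
    rw [PolyEnd.mul_comp, hf] at h1
    have h2 := congrArg totalDegree h1
    simp at h2
  refine mem_triangularSubgroup.2 ⟨a, Units.mk0 b hb, (χ F).coeff 0, c, Units.ext ?_⟩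
  ext1
  funext i
  fin_cases i
  · exact hFeq
  · exact hf

/-- The **Jung–van der Kulk theorem**: the automorphisms of the affine plane are generated by the
affine and the triangular ones. -/
theorem mem_iSup_amalgamFactor [IsAlgClosed k] (f : PolyAut 2 k) : f ∈ ⨆ i, amalgamFactor k i := by
  induction hn : (f.val.comp 1).totalDegree using Nat.strong_induction_on generalizing f with
  | _ n ih =>
  have hlower : ∀ e ∈ ⨆ i, amalgamFactor k i, f * e ∈ ⨆ i, amalgamFactor k i →
      f ∈ ⨆ i, amalgamFactor k i := fun e he h => (Subgroup.mul_mem_cancel_right _ he).1 h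
  by_cases h2 : 2 ≤ n
  · obtain ⟨e, he, hlead⟩ := f.exists_leading_form (by omega)
    refine hlower e he ?_
    have hle : ((f * e).val.comp 1).totalDegree < n + 1 :=
      totalDegree_fin_two_lt (by omega) fun m hm => by
        have := (hlead m hm).1
        omega
    rcases Nat.lt_succ_iff_lt_or_eq.1 hle with hlt | heq
    · exact ih _ hlt _ rfl
    · obtain ⟨e', he', hlt⟩ := (f * e).exists_totalDegree_lt (by omega)
        (fun m hm h => (hlead m hm).2 (by omega))
      exact (Subgroup.mul_mem_cancel_right _ he').1 (ih _ (by omega) _ rfl)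
  · obtain ⟨a, b, c, h⟩ := eq_of_totalDegree_le_one (p := f.val.comp 1) (by omega)
    by_cases ha : a = 0
    · refine Subgroup.mem_iSup_of_mem true (f.mem_triangularSubgroup_of_comp_one (b := b) (c := c) ?_)
      rw [h, ha]
      simp
    -- The triangular factor turns a x + b y + c into x + c, and the swap turns this into y + c.
    · have he : triangular (Units.mk0 a ha)⁻¹ 1
          (Polynomial.C (-a⁻¹ * b) * Polynomial.X) 0 * swap k ∈ ⨆ i, amalgamFactor k i :=
        mul_mem (triangular_mem _ _ _ _) swap_mem
      refine hlower _ he (Subgroup.mem_iSup_of_mem true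
        (PolyAut.mem_triangularSubgroup_of_comp_one _ (b := 1) (c := c) ?_))
      rw [← mul_assoc, mul_val_comp, mul_val_comp, h]
      simp only [algEquiv_apply, map_add, map_mul, bind₁_C_right, bind₁_X_right,
        triangular_comp_zero, triangular_comp_one, ← Polynomial.aeval_algHom_apply, swap_comp_zero,
        swap_comp_one]
      have h1 : (C a * C a⁻¹ : MvPolynomial (Fin 2) k) = 1 := by
        rw [← map_mul, mul_inv_cancel₀ ha, map_one]
      simp [MvPolynomial.algebraMap_eq]
      linear_combination (X 1 - C b * X 0) * h1

end PolyAut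

/-! ### Families of automorphisms over affine charts -/

/-- The functions on `𝔸ⁿ_R` given by the polynomials over `R`. -/
noncomputable def affSpaceEval (n : ℕ) (R : Type u) [CommRing R] :
    MvPolynomial (Fin n) R →+* Γ(affSpace n (Spec (CommRingCat.of R)), ⊤) :=
  MvPolynomial.eval₂Hom
    ((Scheme.ΓSpecIso (CommRingCat.of R)).inv ≫
      (affSpace n (Spec (CommRingCat.of R)) ↘ Spec (CommRingCat.of R)).appTop).hom
    (fun j => AffineSpace.coord (Spec (CommRingCat.of R)) (ULift.up j))

theorem affSpaceEval_X (n : ℕ) (R : Type u) [CommRing R] (j : Fin n) :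
    affSpaceEval n R (MvPolynomial.X j) =
      AffineSpace.coord (Spec (CommRingCat.of R)) (ULift.up j) :=
  MvPolynomial.eval₂Hom_X' _ _ _

theorem affSpaceEval_C (n : ℕ) (R : Type u) [CommRing R] (r : R) :
    affSpaceEval n R (MvPolynomial.C r) =
      (affSpace n (Spec (CommRingCat.of R)) ↘ Spec (CommRingCat.of R)).appTop
        ((Scheme.ΓSpecIso (CommRingCat.of R)).inv r) :=
  MvPolynomial.eval₂Hom_C _ _ _

/-- Up to renaming variables along `ULift`, this is the identification of affine space over Spec R
with the spectrum of a polynomial ring. -/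
theorem affSpaceEval_bijective (n : ℕ) (R : Type u) [CommRing R] :
    Function.Bijective (affSpaceEval n R) := by
  have h := AffineSpace.SpecIso_hom_appTop (n := ULift.{u} (Fin n)) (CommRingCat.of R)
  have h2 : CommRingCat.ofHom (affSpaceEval n R) =
      CommRingCat.ofHom (MvPolynomial.rename (R := R) (ULift.up.{u} : Fin n → _)).toRingHom ≫
        (Scheme.ΓSpecIso _).inv ≫
        (AffineSpace.SpecIso (ULift.{u} (Fin n)) (CommRingCat.of R)).hom.appTop := by
    rw [h, Iso.inv_hom_id_assoc]
    ext : 1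
    apply MvPolynomial.ringHom_ext
    · intro r
      simp [affSpaceEval]
    · intro j
      simp [affSpaceEval]
  have h3 : Function.Bijective (MvPolynomial.rename (R := R) (ULift.up.{u} : Fin n → _)) :=
    (MvPolynomial.renameEquiv R (Equiv.ulift.{u} (α := Fin n)).symm).bijective
  have h4 : IsIso (CommRingCat.ofHom
      (MvPolynomial.rename (R := R) (ULift.up.{u} : Fin n → _)).toRingHom) :=
    (ConcreteCategory.isIso_iff_bijective _).mpr h3
  have h5 : IsIso (CommRingCat.ofHom (affSpaceEval n R)) := by
    rw [h2]
    have h6 : IsIso (AffineSpace.SpecIso (ULift.{u} (Fin n)) (CommRingCat.of R)).hom.appTop := by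
      refine ⟨⟨(AffineSpace.SpecIso (ULift.{u} (Fin n)) (CommRingCat.of R)).inv.appTop, ?_, ?_⟩⟩
      · rw [← Scheme.Hom.comp_appTop, Iso.inv_hom_id, Scheme.Hom.id_appTop]
      · rw [← Scheme.Hom.comp_appTop, Iso.hom_inv_id, Scheme.Hom.id_appTop]
    exact @IsIso.comp_isIso _ _ _ _ _ _ _ h4
      (@IsIso.comp_isIso _ _ _ _ _ _ _ (Iso.isIso_inv _) h6)
  exact (ConcreteCategory.isIso_iff_bijective _).mp h5

/-- Specializing a family at a point thus becomes applying a ring map to coefficients. -/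
theorem affSpaceEval_naturality (n : ℕ) {R S : Type u} [CommRing R] [CommRing S] (β : R →+* S)
    (p : MvPolynomial (Fin n) R) :
    (AffineSpace.map (ULift.{u} (Fin n)) (Spec.map (CommRingCat.ofHom β))).appTop
      (affSpaceEval n R p) = affSpaceEval n S (MvPolynomial.map β p) := by
  have : ((AffineSpace.map (ULift.{u} (Fin n)) (Spec.map (CommRingCat.ofHom β))).appTop).hom.comp
      (affSpaceEval n R) = (affSpaceEval n S).comp (MvPolynomial.map β) := by
    apply MvPolynomial.ringHom_ext
    · intro r
      simp only [RingHom.comp_apply, MvPolynomial.map_C, affSpaceEval_C]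
      have h := AffineSpace.map_over (n := ULift.{u} (Fin n)) (Spec.map (CommRingCat.ofHom β))
      have h2 := congrArg (fun f => f.appTop ((Scheme.ΓSpecIso (CommRingCat.of R)).inv r)) h
      simp only [Scheme.Hom.comp_appTop, CommRingCat.comp_apply] at h2
      refine h2.trans ?_
      congr 1
      have h3 := Scheme.ΓSpecIso_inv_naturality (CommRingCat.ofHom β)
      exact (congrArg (fun f => f.hom r) h3).symm
    · intro j
      simp only [RingHom.comp_apply, MvPolynomial.map_X, affSpaceEval_X]
      exact AffineSpace.map_appTop_coord _ _
  exact congrArg (fun f => f p) this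

theorem PolyEnd.toSchemeHom_appTop_coord {n : ℕ} {R : Type u} [CommRing R] (f : PolyEnd n R)
    (i : Fin n) :
    f.toSchemeHom.appTop (AffineSpace.coord (Spec (CommRingCat.of R)) (ULift.up i)) =
      affSpaceEval n R (f.comp i) :=
  AffineSpace.homOfVector_appTop_coord _ _ _

/-- Over an affine scheme `Spec S` mapping to `A`, a morphism `A → Aut(𝔸ⁿ)` is given by polynomials
with coefficients in `S`. -/
theorem IsMorphismToAut.exists_polyEnd {n : ℕ} {k : Type u} [Field k] {A : Scheme.{u}}
    {π : A ⟶ Spec (CommRingCat.of k)} {F : KPoint π → PolyAut n k} (hF : IsMorphismToAut π F)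
    {S : Type u} [CommRing S] (ι : Spec (CommRingCat.of S) ⟶ A) :
    ∃ f : PolyEnd n S, ∀ (b : KPoint π) (β : S →+* k),
      b.1 = Spec.map (CommRingCat.ofHom β) ≫ ι →
      ∀ i, (F b).val.comp i = MvPolynomial.map β (f.comp i) := by
  obtain ⟨φ, -, hφ⟩ := hF
  -- The polynomial `f i` is the i-th coordinate function of `φ`, restricted over Spec S.
  choose f hf using fun i : Fin n => (affSpaceEval_bijective n S).2
    ((AffineSpace.map (ULift.{u} (Fin n)) ι ≫ φ.hom).appTop
      (AffineSpace.coord A (ULift.up i)))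
  refine ⟨⟨f⟩, fun b β hb i => (affSpaceEval_bijective n k).1 ?_⟩
  rw [← affSpaceEval_naturality, hf, ← PolyEnd.toSchemeHom_appTop_coord]
  have h := hφ b
  have h2 := congrArg (fun g => g.appTop (AffineSpace.coord A (ULift.up i))) h
  rw [Scheme.Hom.comp_appTop, Scheme.Hom.comp_appTop] at h2
  simp only [CommRingCat.comp_apply, AffineSpace.map_appTop_coord] at h2
  refine h2.symm.trans ?_
  rw [hb, AffineSpace.map_comp]
  simp only [Scheme.Hom.comp_appTop, CommRingCat.comp_apply]

/-- Every `k`-point lies in an affine open subscheme, and has arbitrarily small neighbourhoods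
given by the non-vanishing of a function there. -/
theorem KPoint.exists_affine_nhds {k : Type u} [Field k] {A : Scheme.{u}}
    {π : A ⟶ Spec (CommRingCat.of k)} (a : KPoint π) :
    ∃ (S : CommRingCat.{u}) (ι : Spec S ⟶ A) (α : S →+* k),
      a.1 = Spec.map (CommRingCat.ofHom α) ≫ ι ∧
      ∀ s : S, α s ≠ 0 → ∃ V : Set (KPoint π), IsOpen V ∧ a ∈ V ∧
        ∀ b ∈ V, ∃ β : S →+* k, b.1 = Spec.map (CommRingCat.ofHom β) ≫ ι ∧ β s ≠ 0 := by
  set x : A := a.1 (IsLocalRing.closedPoint k) with hx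
  obtain ⟨U, hU, hxU, -⟩ := exists_isAffineOpen_mem_and_subset (X := A) (x := x) (U := ⊤) trivial
  have lift : ∀ b : KPoint π, b.1 (IsLocalRing.closedPoint k) ∈ U →
      ∃ β : Γ(A, U) →+* k, b.1 = Spec.map (CommRingCat.ofHom β) ≫ hU.fromSpec := by
    intro b hb
    have hr : Set.range b.1 ⊆ Set.range hU.fromSpec := by
      rw [hU.range_fromSpec]
      rintro _ ⟨y, rfl⟩
      rwa [Subsingleton.elim y (IsLocalRing.closedPoint k)]
    refine ⟨(Spec.preimage (IsOpenImmersion.lift hU.fromSpec b.1 hr)).hom, ?_⟩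
    rw [CommRingCat.ofHom_hom, Spec.map_preimage, IsOpenImmersion.lift_fac]
  have key : ∀ (β : Γ(A, U) →+* k) (s : Γ(A, U)),
      (Spec.map (CommRingCat.ofHom β) ≫ hU.fromSpec) (IsLocalRing.closedPoint k) ∈
        A.basicOpen s ↔ β s ≠ 0 := by
    intro β s
    have h1 : (Spec.map (CommRingCat.ofHom β) ≫ hU.fromSpec) (IsLocalRing.closedPoint k) ∈
        A.basicOpen s ↔ (Spec.map (CommRingCat.ofHom β)) (IsLocalRing.closedPoint k) ∈
        hU.fromSpec ⁻¹ᵁ A.basicOpen s := Iff.rfl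
    rw [h1, hU.fromSpec_preimage_basicOpen]
    have h2 : (Spec.map (CommRingCat.ofHom β)) (IsLocalRing.closedPoint k) ∈
        PrimeSpectrum.basicOpen s ↔ β s ∉ IsLocalRing.maximalIdeal k := Iff.rfl
    refine h2.trans ?_
    rw [IsLocalRing.maximalIdeal_eq_bot]
    rfl
  obtain ⟨α, hα⟩ := lift a hxU
  refine ⟨_, hU.fromSpec, α, hα, fun s hs =>
    ⟨{b | b.1 (IsLocalRing.closedPoint k) ∈ A.basicOpen s}, ?_, ?_, ?_⟩⟩
  · exact isOpen_induced_iff.mpr ⟨_, (A.basicOpen s).2, rfl⟩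
  · rw [Set.mem_ofPred_eq, hα]
    exact (key α s).2 hs
  · intro b hb
    obtain ⟨β, hβ⟩ := lift b (A.basicOpen_le s hb)
    refine ⟨β, hβ, (key β s).1 ?_⟩
    rw [← hβ]
    exact hb

namespace PolyEnd

variable {n : ℕ} {R S : Type u} [CommRing R] [CommRing S]

/-- Base change of polynomial endomorphisms. -/
noncomputable def map (β : R →+* S) : PolyEnd n R →* PolyEnd n S where
  toFun f := ⟨fun i => MvPolynomial.map β (f.comp i)⟩
  map_one' := by
    ext1
    funext i
    exact MvPolynomial.map_X _ _
  map_mul' f g := by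
    ext1
    funext i
    exact MvPolynomial.map_bind₁ _ _ _

theorem map_comp (β : R →+* S) (f : PolyEnd n R) (i : Fin n) :
    (map β f).comp i = MvPolynomial.map β (f.comp i) := rfl

theorem degree_map_le (β : R →+* S) (f : PolyEnd n R) : (map β f).degree ≤ f.degree :=
  (degree_le_iff _ _).2 fun i => by
    rw [map_comp]
    refine le_trans ?_ (f.totalDegree_le_degree i)
    exact Finset.sup_mono (MvPolynomial.support_map_subset β (f.comp i))

end PolyEnd

/-! ### Algebraic elements: the degree criterion and closedness -/

namespace PolyAut

variable {k : Type u} [Field k] [IsAlgClosed k]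

/-- Boundedness rules out exponential growth. The bound by deg f, in place of an unspecified
constant, is what makes the condition closed in families. -/
theorem isAlgebraic_iff_forall_degree_pow_le (f : PolyAut 2 k) :
    IsAlgebraic f ↔ ∀ m, degree (f ^ (m + 1)) ≤ degree f := by
  constructor
  · rintro ⟨D, hD⟩
    refine (degree_pow_dichotomy f.mem_iSup_amalgamFactor).resolve_right fun h => ?_
    have h1 : degree (f ^ (D + 1)) ≤ D := hD ⟨D + 1, rfl⟩
    have h2 := h D
    have h3 : 2 ^ D * 1 ≤ 2 ^ D * degree f := Nat.mul_le_mul_left _ (one_le_degree f)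
    have h4 : D < 2 ^ D := Nat.lt_two_pow_self
    omega
  · intro h
    refine ⟨degree f, ?_⟩
    rintro _ ⟨m, rfl⟩
    rcases m with _ | m
    · simpa [degree_one] using one_le_degree f
    · exact h m

/-- In the growing case deg f² ≥ 2 deg f > deg f. -/
theorem isAlgebraic_iff_degree_sq_le (f : PolyAut 2 k) :
    IsAlgebraic f ↔ degree (f ^ 2) ≤ degree f := by
  rw [isAlgebraic_iff_forall_degree_pow_le]
  refine ⟨fun h => h 1, fun h => ?_⟩
  refine (degree_pow_dichotomy f.mem_iSup_amalgamFactor).resolve_right fun h' => ?_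
  have h1 : 2 ^ 1 * degree f ≤ degree (f ^ 2) := h' 1
  have := one_le_degree f
  omega

theorem isClosed_setOf_isAlgebraic : IsClosed {f : PolyAut 2 k | IsAlgebraic f} := by
  rw [PolyAut.isClosed_iff]
  intro A π _ F hF
  rw [← isOpen_compl_iff, isOpen_iff_forall_mem_open]
  intro a ha
  obtain ⟨S, ι, α, hα, hnhds⟩ := a.exists_affine_nhds
  obtain ⟨g, hg⟩ := hF.exists_polyEnd (S := S) ι
  have hval : ∀ (b : KPoint π) (β : S →+* k), b.1 = Spec.map (CommRingCat.ofHom β) ≫ ι →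
      ∀ m : ℕ, (F b ^ m).val = PolyEnd.map β (g ^ m) := by
    intro b β hb m
    have h1 : (F b).val = PolyEnd.map β g := by
      ext1
      funext i
      exact hg b β hb i
    rw [Units.val_pow_eq_pow_val, h1, map_pow]
  -- The threshold is deg g rather than the degree at `a`, because it bounds the degrees of all
  -- members over the chart at once.
  have hnot : ∃ m, g.degree < degree (F a ^ m) := by
    by_contra hcon
    push Not at hcon
    refine ha ⟨g.degree, ?_⟩
    rintro _ ⟨m, rfl⟩
    exact hcon m
  obtain ⟨m, hm⟩ := hnot
  have hcoeff : ∃ i d, g.degree < Finsupp.degree d ∧ ((F a ^ m).val.comp i).coeff d ≠ 0 := by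
    by_contra hcon
    push Not at hcon
    refine absurd ((PolyEnd.degree_le_iff _ _).2 fun i => ?_) (not_le.2 hm)
    refine Finset.sup_le fun d hd => ?_
    by_contra hlt
    exact MvPolynomial.mem_support_iff.1 hd (hcon i d (not_le.1 hlt))
  obtain ⟨i, d, hd, hne⟩ := hcoeff
  rw [hval a α hα m, PolyEnd.map_comp, MvPolynomial.coeff_map] at hne
  -- The coefficient of `g ^ m` at `d` is a function on the chart that is nonzero at `a`; on `V` it
  -- remains nonzero, so the m-th power keeps degree above deg g.
  obtain ⟨V, hV, haV, hVs⟩ := hnhds _ hne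
  refine ⟨V, fun b hb halg => ?_, hV, haV⟩
  obtain ⟨β, hβ, hβs⟩ := hVs b hb
  have hle : degree (F b) ≤ g.degree := by
    have h1 := hval b β hβ 1
    rw [pow_one, pow_one] at h1
    rw [degree, h1]
    exact PolyEnd.degree_map_le _ _
  rw [← MvPolynomial.coeff_map, ← PolyEnd.map_comp, ← hval b β hβ m] at hβs
  have h2 : g.degree < degree (F b ^ m) := by
    refine hd.trans_le (le_trans ?_ ((F b ^ m).val.totalDegree_le_degree i))
    exact MvPolynomial.le_totalDegree (MvPolynomial.mem_support_iff.2 hβs)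
  have h3 : degree (F b ^ m) ≤ degree (F b) := by
    rcases m with _ | m
    · rw [pow_zero, degree_one]
      exact one_le_degree _
    · exact (isAlgebraic_iff_forall_degree_pow_le _).1 halg m
  omega

end PolyAut

theorem mainTheorem6 {k : Type u} [Field k] [IsAlgClosed k] :
    (∀ f : SAut 2 k, PolyAut.IsAlgebraic (f : PolyAut 2 k) ↔
      PolyAut.degree ((f : PolyAut 2 k) ^ 2) ≤ PolyAut.degree (f : PolyAut 2 k)) ∧
    IsClosed {f : SAut 2 k | PolyAut.IsAlgebraic (f : PolyAut 2 k)} :=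
  ⟨fun f => PolyAut.isAlgebraic_iff_degree_sq_le (f : PolyAut 2 k),
    PolyAut.isClosed_setOf_isAlgebraic.preimage continuous_subtype_val⟩
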